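/- Let $d\ge 1$ and $k\ge d+3$. Let $\mathrm{PGL}(d+1)=\mathrm{GL}(d+1,\mathbb R)/(\mathbb R\setminus\{0\})$ act diagonally on $(\mathbb{RP}^d)^k$, and let $a_d^k=(\mathbb{RP}^d)^k/\mathrm{PGL}(d+1)$, with the quotient topology, be the space of projective shapes of $k$ landmarks in $\mathbb{RP}^d$. Write $[p]$ for the shape of a configuration $p=(p_1,\dots,p_k)$. Call $p$ *free* if $\{g\in\mathrm{PGL}(d+1): gp=p\}=\{e\}$, and let $f_d^k\subseteq a_d^k$, with the subspace topology, be the set of shapes of free configurations. A *pseudo-frame* $F$ consists of distinct indices $b_0,\dots,b_d\in\{1,\dots,k\}$ and a tree $G$ on the vertices $0,\dots,d$ each of whose edges is labelled by an index $l\in\{1,\dots,k\}\setminus\{b_0,\dots,b_d\}$. A configuration $p$ *contains* $F$ if $p_{b_0},\dots,p_{b_d}$ are in general position and, for each edge $\{i,j\}$ of $G$ with label $l$, the $i$-th and $j$-th coordinates of $p_l$ with respect to (representatives of) $p_{b_0},\dots,p_{b_d}$ are both non-zero. A *pivot* for $F$ is a function $c$ from the indices $l\notin\{b_0,\dots,b_d\}$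 to $\{0,\dots,d\}$ such that, if $l$ is the label of some edge, then $c(l)$ is an end of an edge with label $l$. Let $U_{F,c}\subseteq f_d^k$ be the set of free shapes $[p]$ such that $p$ contains $F$ and the $c(l)$-th coordinate of $p_l$ with respect to $p_{b_0},\dots,p_{b_d}$ is non-zero for all $l\notin\{b_0,\dots,b_d\}$. A real $k\times(d+1)$-matrix $X$ is in *normal form* for $(F,c)$ if row $b_i$ is the $i$-th standard basis vector for $i=0,\dots,d$, $X_{li}=X_{lj}$ for each edge $\{i,j\}$ of $G$ with label $l$, and $X_{l,c(l)}=1$ for all $l\notin\{b_0,\dots,b_d\}$. A *chart given by $(F,c)$* is a homeomorphism $e$ from $U_{F,c}$ (which is open in $f_d^k$) onto an open subset of $\mathbb R^{d(k-d-2)}$ for which there is an injective affine map $A$ from $\mathbb R^{d(k-d-2)}$ to the $k\times(d+1)$-matrices such that for each $s\in U_{F,c}$ the matrix $A(e(s))$ is in normal form for $(F,c)$ and its rows are homogeneous coordinates of a configuration of shape $s$. **Theorem.** 1. For every pseudo-frame $F$ and every pivot $c$ for $F$ there is a chart given by $(F,c)$. The set of all charts given by pseudo-frames and pivots is a smooth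 ($C^\infty$) atlas on $f_d^k$ (in particular the domains cover $f_d^k$). With this atlas $f_d^k$ is a smooth manifold of dimension $d(k-d-2)$, i.e. locally Euclidean with smooth transition maps; moreover $f_d^k$ is second countable. 2. $f_d^k$ is T1 but not Hausdorff. 3. $f_d^k$ is open in $a_d^k$, and every free shape $s$ is unblurry, i.e. the intersection of all open neighbourhoods of $s$ in $a_d^k$ is $\{s\}$. -/

import Mathlib

open scoped LinearAlgebra.Projectivization Manifold ContDiff

noncomputable section

namespace ProjectiveShape

/-- Real projective space `ℝP^d`: lines through the origin of `ℝ^{d+1}`. -/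
abbrev RP (d : ℕ) : Type := ℙ ℝ (Fin (d + 1) → ℝ)

/-- The topology of `ℝP^d` is the quotient topology from `ℝ^{d+1} ∖ {0}`. -/
instance instTopologicalSpaceRP (d : ℕ) : TopologicalSpace (RP d) :=
  inferInstanceAs (TopologicalSpace
    (Quotient (projectivizationSetoid ℝ (Fin (d + 1) → ℝ))))

/-- The projective linear group `PGL(d+1) = GL(d+1) / (ℝ ∖ {0})`. -/
abbrev PGL (d : ℕ) : Type := Matrix.ProjGenLinGroup (Fin (d + 1)) ℝ

/-- Configurations of `k` landmarks in `ℝP^d`, with the product topology;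
`PGL(d+1)` acts landmark by landmark. -/
abbrev Config (d k : ℕ) : Type := Fin k → RP d

/-- The space of projective shapes of `k` landmarks in `ℝP^d`, i.e. the orbit space
`(ℝP^d)^k / PGL(d+1)`, with the quotient topology. -/
abbrev Shape (d k : ℕ) : Type := Quotient (MulAction.orbitRel (PGL d) (Config d k))

/-- The shape of a configuration. -/
def shape {d k : ℕ} (p : Config d k) : Shape d k :=
  Quotient.mk (MulAction.orbitRel (PGL d) (Config d k)) p

/-- A configuration is free if its isotropy group in `PGL(d+1)` is trivial. -/
def IsFree {d k : ℕ} (p : Config d k) : Prop :=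
  MulAction.stabilizer (PGL d) p = ⊥

/-- The set of free shapes, as a subset of the space of all projective shapes. -/
def freeShapes (d k : ℕ) : Set (Shape d k) := shape '' {p | IsFree p}

/-- The space of free shapes, with the subspace topology. -/
abbrev FreeShape (d k : ℕ) : Type := ↥(freeShapes d k)

/-- The blur of a point: the intersection of all its open neighbourhoods. -/
def blur {M : Type*} [TopologicalSpace M] (x : M) : Set M :=
  ⋂₀ {U : Set M | IsOpen U ∧ x ∈ U}

/-- A point is unblurry if its blur consists of the point alone. -/
def Unblurry {M : Type*} [TopologicalSpace M] (x : M) : Prop := blur x = {x}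

/-- A `k × (d+1)` matrix of homogeneous coordinates of a configuration. -/
def homMatrix {d k : ℕ} (p : Config d k) : Matrix (Fin k) (Fin (d + 1)) ℝ :=
  Matrix.of fun l => (p l).rep

/-- Homogeneous coordinates with respect to the landmarks with indices `b 0, …, b d`: the matrix
`P * P₀⁻¹`, where `P₀` consists of the rows `b 0, …, b d` of `P`. It is only used if these landmarks
are in general position; it is then well defined up to multiplication of its rows and columns by
non-zero scalars. -/
def coordMatrix {d k : ℕ} (p : Config d k) (b : Fin (d + 1) ↪ Fin k) :
    Matrix (Fin k) (Fin (d + 1)) ℝ :=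
  homMatrix p * ((homMatrix p).submatrix b id)⁻¹

/-- The edges of colour `l` of the edge-coloured graph of a configuration `p` whose landmarks
`b 0, …, b d` are in general position: `i` and `j` are joined by an edge of colour `l`, where
`l` is one of the other landmarks, if the `i`-th and `j`-th coordinates of that landmark with respect
to the landmarks `b 0, …, b d` are both non-zero. -/
def colourGraph {d k : ℕ} (p : Config d k) (b : Fin (d + 1) ↪ Fin k) (l : Fin k) :
    SimpleGraph (Fin (d + 1)) where
  Adj i j := i ≠ j ∧ l ∉ Set.range b ∧ coordMatrix p b l i ≠ 0 ∧ coordMatrix p b l j ≠ 0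
  symm := ⟨fun _ _ h => ⟨h.1.symm, h.2.1, h.2.2.2, h.2.2.1⟩⟩
  loopless := ⟨fun _ h => h.1 rfl⟩

/-- A pseudo-frame: `d + 1` landmark indices `b 0, …, b d` together with a tree on the vertices
`0, …, d` (standing for these landmarks) whose edges are labelled by other landmarks. -/
structure PseudoFrame (d k : ℕ) where
  base : Fin (d + 1) ↪ Fin k
  tree : SimpleGraph (Fin (d + 1))
  isTree : tree.IsTree
  label : tree.edgeSet → Fin k
  label_notMem : ∀ e, label e ∉ Set.range base

/-- A configuration contains the pseudo-frame `F` if its landmarks `b 0, …, b d` are in general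
position and the labelled tree is a subgraph of its edge-coloured graph. -/
def PseudoFrame.ContainedIn {d k : ℕ} (F : PseudoFrame d k) (p : Config d k) : Prop :=
  Projectivization.Independent (fun i => p (F.base i)) ∧
    ∀ (i j : Fin (d + 1)) (h : F.tree.Adj i j),
      (colourGraph p F.base (F.label ⟨s(i, j), h⟩)).Adj i j

/-- A pivot for `F` selects for each landmark the coordinate that will be normalised to `1`; for a
landmark that labels an edge of the tree, this must be an end of such an edge. -/
def PseudoFrame.IsPivot {d k : ℕ} (F : PseudoFrame d k) (c : Fin k → Fin (d + 1)) : Prop :=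
  ∀ e : F.tree.edgeSet, ∃ e' : F.tree.edgeSet, F.label e' = F.label e ∧ c (F.label e) ∈ e'.1

/-- The normal form of a matrix of homogeneous coordinates with respect to a pseudo-frame and a
pivot: the landmarks `b 0, …, b d` are the standard basis vectors, for each edge of the tree the two
coordinates of its label at its ends agree, and the pivot coordinates are `1`. (If the edges with
label `l` form a connected graph, then the coordinates of `l` at all ends of these edges
are `1`.) -/
structure PseudoFrame.IsNormalForm {d k : ℕ} (F : PseudoFrame d k) (c : Fin k → Fin (d + 1))
    (X : Matrix (Fin k) (Fin (d + 1)) ℝ) : Prop where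
  base_row : ∀ i, X (F.base i) = Pi.single i 1
  edge : ∀ (i j : Fin (d + 1)) (h : F.tree.Adj i j),
    X (F.label ⟨s(i, j), h⟩) i = X (F.label ⟨s(i, j), h⟩) j
  pivot : ∀ l, l ∉ Set.range F.base → X l (c l) = 1

/-- The rows of the matrix `X` are homogeneous coordinates of a configuration of shape `s`. -/
def Represents {d k : ℕ} (X : Matrix (Fin k) (Fin (d + 1)) ℝ) (s : Shape d k) : Prop :=
  ∃ hX : ∀ l, X l ≠ 0, shape (fun l => Projectivization.mk ℝ (X l) (hX l)) = s

/-- The free shapes that contain the pseudo-frame `F` and whose remaining landmarks have non-zero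
pivot coordinates. -/
def PseudoFrame.chartDomain {d k : ℕ} (F : PseudoFrame d k) (c : Fin k → Fin (d + 1)) :
    Set (FreeShape d k) :=
  {s | ∃ p : Config d k, shape p = s.1 ∧ F.ContainedIn p ∧
    ∀ l, l ∉ Set.range F.base → coordMatrix p F.base l (c l) ≠ 0}

/-- `e` is a chart given by the pseudo-frame `F` and the pivot `c`: it is defined on
`F.chartDomain c`, and sends a shape to its normal form, read in affine coordinates `A` on
the space of matrices in normal form. -/
structure PseudoFrame.IsChart {d k n : ℕ} (F : PseudoFrame d k) (c : Fin k → Fin (d + 1))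
    (e : OpenPartialHomeomorph (FreeShape d k) (EuclideanSpace ℝ (Fin n))) : Prop where
  isPivot : F.IsPivot c
  source_eq : e.source = F.chartDomain c
  normalForm : ∃ A : EuclideanSpace ℝ (Fin n) →ᵃ[ℝ] Matrix (Fin k) (Fin (d + 1)) ℝ,
    Function.Injective A ∧
      ∀ s ∈ e.source, F.IsNormalForm c (A (e s)) ∧ Represents (A (e s)) s.1

end ProjectiveShape

end

open scoped LinearAlgebra.Projectivization Manifold ContDiff

noncomputable section

namespace ProjectiveShape

open Matrix Topology

variable {d k : ℕ}

/-! A configuration is a matrix with non-zero rows, and two matrices have the same shape iff they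
differ by non-zero row factors and an invertible factor on the right (`HomCoord.shape_eq_iff`). The
projection from matrices to shapes is an open quotient map, so topological questions about shapes
can be settled on matrices.

Coordinates relative to d + 1 landmarks in general position absorb the right factor. Only row and
column factors remain (`relCoord_diagonal_mul_mul`), and these preserve the pattern of zeros. An
edge of the tree ties two column factors together, hence a pseudo-frame ties all of them, and the
pivots then determine the row factors. So the isotropy is trivial (`PseudoFrame.Generic.isFree`) and
normal forms are unique; they exist because suitable column factors can be built by multiplying
ratios along tree paths.

Conversely, freeness forces a pseudo-frame: landmarks that do not span are fixed by a transvection,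
and a disconnected graph of shared non-zero coordinates admits a diagonal isotropy with two
eigenvalues. Hence the chart domains cover the free shapes.

Normal forms make up an affine space whose dimension is found by counting equations, and
normalisation is rational in the entries, so the charts are continuous and their transition maps
smooth. T1 is inherited from Euclidean space and yields unblurriness. Hausdorffness fails on two
curves of shapes that agree for all parameters but one. -/

/-! ### Homogeneous coordinates and open quotient maps. -/

/-- Choices of homogeneous coordinates for `k` landmarks in `ℝP^d`. -/
abbrev HomCoord (d k : ℕ) : Type := Fin k → {v : Fin (d + 1) → ℝ // v ≠ 0}

/-- The matrix whose rows are the given homogeneous coordinates. -/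
def HomCoord.toMatrix (X : HomCoord d k) : Matrix (Fin k) (Fin (d + 1)) ℝ :=
  Matrix.of fun l => (X l).1

/-- The configuration with the given homogeneous coordinates. -/
def HomCoord.config (X : HomCoord d k) : Config d k :=
  fun l => Projectivization.mk ℝ (X l).1 (X l).2

/-- The shape of the configuration with the given homogeneous coordinates. -/
def HomCoord.shape (X : HomCoord d k) : Shape d k := ProjectiveShape.shape X.config

/-- The canonical representatives of a configuration. -/
def rep (p : Config d k) : HomCoord d k := fun l => ⟨(p l).rep, (p l).rep_nonzero⟩

@[simp] lemma config_rep (p : Config d k) : (rep p).config = p := by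
  funext l; exact Projectivization.mk_rep _

@[simp] lemma shape_rep (p : Config d k) : (rep p).shape = shape p := by
  simp [HomCoord.shape]

instance : ContinuousConstSMul (PGL d) (RP d) where
  continuous_const_smul g := by
    induction g using Matrix.ProjGenLinGroup.induction_on with | mk g =>
    refine continuous_quot_lift (r := (projectivizationSetoid ℝ (Fin (d + 1) → ℝ)).r)
      (f := fun v => (Projectivization.mk ℝ (g • v.1) ((smul_ne_zero_iff_ne g).2 v.2) : RP d))
      (fun a b h => congrArg (fun x : RP d => (Matrix.ProjGenLinGroup.mk g : PGL d) • x)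
        (Quotient.sound h : (Projectivization.mk' ℝ a : RP d) = Projectivization.mk' ℝ b)) ?_
    have h : Continuous (fun v : {v : Fin (d + 1) → ℝ // v ≠ 0} =>
        (⟨g • v.1, (smul_ne_zero_iff_ne g).2 v.2⟩ : {v : Fin (d + 1) → ℝ // v ≠ 0})) := by
      refine Continuous.subtype_mk ?_ _
      exact (Continuous.matrix_mulVec (continuous_const (y := g.1)) continuous_subtype_val :)
    exact (continuous_quotient_mk' (s := projectivizationSetoid ℝ (Fin (d + 1) → ℝ))).comp h

/-- The saturation of an open set is the union of its multiples by non-zero scalars, each of which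
is open. -/
lemma isOpenQuotientMap_projectivization_mk :
    IsOpenQuotientMap (fun v : {v : Fin (d + 1) → ℝ // v ≠ 0} =>
      (Projectivization.mk ℝ v.1 v.2 : RP d)) := by
  refine ⟨Quotient.mk_surjective, continuous_quotient_mk', fun U hU => ?_⟩
  have : IsQuotientMap (fun v : {v : Fin (d + 1) → ℝ // v ≠ 0} =>
      (Projectivization.mk ℝ v.1 v.2 : RP d)) := isQuotientMap_quotient_mk'
  rw [← this.isOpen_preimage]
  have heq : (fun v : {v : Fin (d + 1) → ℝ // v ≠ 0} => (Projectivization.mk ℝ v.1 v.2 : RP d)) ⁻¹'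
      ((fun v => Projectivization.mk ℝ v.1 v.2) '' U) =
      ⋃ a : ℝˣ, {v | (⟨a • v.1, (smul_ne_zero_iff_ne a).2 v.2⟩ :
        {v : Fin (d + 1) → ℝ // v ≠ 0}) ∈ U} := by
    ext v
    simp only [Set.mem_preimage, Set.mem_image, Set.mem_iUnion, Set.mem_ofPred_eq,
      Projectivization.mk_eq_mk_iff]
    constructor
    · rintro ⟨w, hw, a, ha⟩
      exact ⟨a, by convert hw⟩
    · rintro ⟨a, ha⟩
      exact ⟨_, ha, a, rfl⟩
  rw [heq]
  refine isOpen_iUnion fun a => hU.preimage (Continuous.subtype_mk ?_ _)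
  exact continuous_subtype_val.const_smul a

lemma isOpenQuotientMap_shape : IsOpenQuotientMap (shape : Config d k → Shape d k) :=
  MulAction.isOpenQuotientMap_quotientMk

/-- Openness is what lets the quotient property pass to the product over the landmarks. -/
lemma isOpenQuotientMap_homCoordShape :
    IsOpenQuotientMap (HomCoord.shape : HomCoord d k → Shape d k) :=
  isOpenQuotientMap_shape.comp (IsOpenQuotientMap.piMap fun _ : Fin k =>
    isOpenQuotientMap_projectivization_mk (d := d))

/-! ### Shape and freeness in terms of matrices. -/

/-- Two matrices differ by multiplication of the rows with non-zero scalars and by an invertible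
matrix from the right. -/
def RowColEquiv (X Y : Matrix (Fin k) (Fin (d + 1)) ℝ) : Prop :=
  ∃ D : Fin k → ℝ, (∀ l, D l ≠ 0) ∧ ∃ B : GL (Fin (d + 1)) ℝ, Y = diagonal D * X * B.1

/-- The transpose appears because landmarks are rows while g acts on column vectors. -/
lemma HomCoord.smul_config_eq_iff (g : GL (Fin (d + 1)) ℝ) (X Y : HomCoord d k) :
    (Matrix.ProjGenLinGroup.mk g : PGL d) • X.config = Y.config ↔
      ∃ D : Fin k → ℝ, (∀ l, D l ≠ 0) ∧ diagonal D * Y.toMatrix = X.toMatrix * g.1ᵀ := by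
  have key : ∀ l (a : ℝ), (a • (Y l).1 = g • (X l).1 ↔
      ∀ j, a * Y.toMatrix l j = (X.toMatrix * g.1ᵀ) l j) := by
    intro l a
    rw [funext_iff]
    refine forall_congr' fun j => ?_
    rw [show (X.toMatrix * g.1ᵀ) l j = (g • (X l).1) j from ?_]
    · rfl
    · change _ = (g.1 *ᵥ (X l).1) j
      simp [Matrix.mul_apply, mulVec, dotProduct, HomCoord.toMatrix, mul_comm]
  constructor
  · intro h
    have h' : ∀ l, ∃ a : ℝˣ, a • (Y l).1 = g • (X l).1 := fun l =>
      (Projectivization.mk_eq_mk_iff ℝ _ _ _ _).1 (congrFun h l)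
    choose a ha using h'
    refine ⟨fun l => (a l : ℝ), fun l => (a l).ne_zero, ?_⟩
    ext l j
    rw [diagonal_mul]
    exact (key l _).1 (ha l) j
  · rintro ⟨D, hD, h⟩
    funext l
    refine (Projectivization.mk_eq_mk_iff ℝ _ _ _ _).2 ⟨Units.mk0 (D l) (hD l), ?_⟩
    refine (key l _).2 fun j => ?_
    rw [← h, diagonal_mul, Units.val_mk0]

lemma HomCoord.shape_eq_iff (X Y : HomCoord d k) :
    X.shape = Y.shape ↔ RowColEquiv X.toMatrix Y.toMatrix := by
  have h1 : X.shape = Y.shape ↔ ∃ g : PGL d, g • X.config = Y.config := by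
    rw [eq_comm]; exact Quotient.eq (r := MulAction.orbitRel (PGL d) (Config d k))
  rw [h1]
  constructor
  · rintro ⟨g, hg⟩
    induction g using Matrix.ProjGenLinGroup.induction_on with | mk g =>
    obtain ⟨D, hD, h⟩ := (smul_config_eq_iff g X Y).1 hg
    have hgT : IsUnit (g.1ᵀ) := by rw [isUnit_transpose]; exact g.isUnit
    refine ⟨fun l => (D l)⁻¹, fun l => inv_ne_zero (hD l), hgT.unit, ?_⟩
    rw [IsUnit.unit_spec, Matrix.mul_assoc, ← h, ← Matrix.mul_assoc, diagonal_mul_diagonal]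
    simp [hD]
  · rintro ⟨D, hD, B, h⟩
    have hB : IsUnit (B.1ᵀ) := by rw [isUnit_transpose]; exact B.isUnit
    refine ⟨Matrix.ProjGenLinGroup.mk hB.unit, (smul_config_eq_iff _ X Y).2
      ⟨fun l => (D l)⁻¹, fun l => inv_ne_zero (hD l), ?_⟩⟩
    rw [IsUnit.unit_spec, h, ← Matrix.mul_assoc, ← Matrix.mul_assoc, diagonal_mul_diagonal]
    simp [hD]

/-- Isotropy means that every row is an eigenvector of g. The eigenvalues need not be assumed
non-zero: g is invertible and the rows do not vanish. -/
lemma HomCoord.isFree_iff (X : HomCoord d k) : IsFree X.config ↔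
    ∀ (g : GL (Fin (d + 1)) ℝ) (D : Fin k → ℝ), diagonal D * X.toMatrix = X.toMatrix * g.1 →
      g.1 ∈ Set.range (Matrix.scalar (Fin (d + 1))) := by
  rw [IsFree, Subgroup.eq_bot_iff_forall]
  constructor
  · intro h g D hg
    have hgT : IsUnit (g.1ᵀ) := by rw [isUnit_transpose]; exact g.isUnit
    have hD : ∀ l, D l ≠ 0 := by
      intro l hl
      have h2 : (X.toMatrix l) ᵥ* g.1 = 0 := by
        have := congrFun hg l
        rw [Matrix.mul_apply_eq_vecMul, Matrix.mul_apply_eq_vecMul] at this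
        rw [← this]
        ext j; simp [hl, vecMul, dotProduct, diagonal_apply]
      have h3 : X.toMatrix l = 0 := by
        have h4 := congrArg (· ᵥ* g.2) h2
        have h5 := g.3
        simpa [vecMul_vecMul, h5] using h4
      exact (X l).2 h3
    have := h (Matrix.ProjGenLinGroup.mk hgT.unit) (MulAction.mem_stabilizer_iff.2 <|
      (smul_config_eq_iff _ X X).2 ⟨D, hD, by simpa using hg⟩)
    rw [Matrix.ProjGenLinGroup.mk_eq_one,
      Matrix.GeneralLinearGroup.mem_center_iff_val_mem_range_scalar] at this
    obtain ⟨a, ha⟩ := this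
    refine ⟨a, ?_⟩
    have := congrArg Matrix.transpose ha
    simpa using this
  · intro h g hg
    induction g using Matrix.ProjGenLinGroup.induction_on with | mk g =>
    obtain ⟨D, hD, h2⟩ := (smul_config_eq_iff g X X).1 (MulAction.mem_stabilizer_iff.1 hg)
    have hgT : IsUnit (g.1ᵀ) := by rw [isUnit_transpose]; exact g.isUnit
    obtain ⟨a, ha⟩ := h hgT.unit D h2
    rw [Matrix.ProjGenLinGroup.mk_eq_one,
      Matrix.GeneralLinearGroup.mem_center_iff_val_mem_range_scalar]
    refine ⟨a, ?_⟩
    have := congrArg Matrix.transpose ha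
    simpa using this

lemma represents_iff {X : Matrix (Fin k) (Fin (d + 1)) ℝ} {s : Shape d k} :
    Represents X s ↔ ∃ Y : HomCoord d k, Y.toMatrix = X ∧ Y.shape = s :=
  ⟨fun ⟨h, hs⟩ => ⟨fun l => ⟨X l, h l⟩, rfl, hs⟩, by
    rintro ⟨Y, rfl, rfl⟩; exact ⟨fun l => (Y l).2, rfl⟩⟩

/-- Stabilizers along an orbit are conjugate, so freeness depends on the shape alone. -/
lemma HomCoord.isFree_iff_shape_mem (X : HomCoord d k) :
    X.shape ∈ freeShapes d k ↔ IsFree X.config := by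
  refine ⟨?_, fun h => ⟨_, h, rfl⟩⟩
  rintro ⟨p, hp, hs⟩
  obtain ⟨g, hg : g • X.config = p⟩ := Quotient.exact hs
  have hp : IsFree p := hp
  rw [IsFree, ← hg, MulAction.stabilizer_smul_eq_stabilizer_map_conj] at hp
  rw [IsFree]
  exact (Subgroup.map_eq_bot_iff_of_injective _ (MulEquiv.injective _)).1 hp

/-! ### Coordinates relative to a base. -/

/-- The coordinates of the rows of `X` with respect to the rows `b 0, …, b d`. -/
def relCoord (b : Fin (d + 1) ↪ Fin k) (X : Matrix (Fin k) (Fin (d + 1)) ℝ) :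
    Matrix (Fin k) (Fin (d + 1)) ℝ :=
  X * (X.submatrix b id)⁻¹

lemma submatrix_diagonal_mul_mul (b : Fin (d + 1) → Fin k) (D : Fin k → ℝ)
    (X : Matrix (Fin k) (Fin (d + 1)) ℝ) (B : Matrix (Fin (d + 1)) (Fin (d + 1)) ℝ) :
    (diagonal D * X * B).submatrix b id = diagonal (D ∘ b) * X.submatrix b id * B := by
  ext i j
  simp [Matrix.mul_apply, diagonal_apply]

/-- B cancels against its inverse in the base block, and the row factors of the base landmarks come
back as inverse column factors. -/
lemma relCoord_diagonal_mul_mul (b : Fin (d + 1) ↪ Fin k) {D : Fin k → ℝ} (hD : ∀ l, D l ≠ 0)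
    (X : Matrix (Fin k) (Fin (d + 1)) ℝ) (B : GL (Fin (d + 1)) ℝ) (l : Fin k) (j : Fin (d + 1)) :
    relCoord b (diagonal D * X * B.1) l j = D l * relCoord b X l j * (D (b j))⁻¹ := by
  have h1 : (diagonal (D ∘ b))⁻¹ = diagonal fun i => (D (b i))⁻¹ := by
    refine Matrix.inv_eq_right_inv ?_
    rw [diagonal_mul_diagonal]
    simp [hD]
  have h2 : B.1 * B.1⁻¹ = 1 := Matrix.mul_nonsing_inv _ ((isUnit_iff_isUnit_det _).1 B.isUnit)
  have h3 : relCoord b (diagonal D * X * B.1) =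
      diagonal D * relCoord b X * diagonal fun i => (D (b i))⁻¹ := by
    rw [relCoord, submatrix_diagonal_mul_mul, Matrix.mul_inv_rev, Matrix.mul_inv_rev, h1, relCoord]
    calc _ = diagonal D * X * (B.1 * B.1⁻¹) * ((X.submatrix b id)⁻¹ *
          diagonal fun i => (D (b i))⁻¹) := by simp only [Matrix.mul_assoc]
      _ = _ := by rw [h2]; simp only [Matrix.mul_assoc, Matrix.mul_one]
  rw [h3, mul_diagonal, diagonal_mul]

lemma relCoord_mul_base {b : Fin (d + 1) ↪ Fin k} {X : Matrix (Fin k) (Fin (d + 1)) ℝ}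
    (h : IsUnit (X.submatrix b id)) : relCoord b X * X.submatrix b id = X := by
  rw [relCoord, Matrix.mul_assoc, Matrix.nonsing_inv_mul _ ((isUnit_iff_isUnit_det _).1 h),
    Matrix.mul_one]

lemma relCoord_base {b : Fin (d + 1) ↪ Fin k} {X : Matrix (Fin k) (Fin (d + 1)) ℝ}
    (h : IsUnit (X.submatrix b id)) (i : Fin (d + 1)) : relCoord b X (b i) = Pi.single i 1 := by
  have h1 := Matrix.mul_nonsing_inv _ ((isUnit_iff_isUnit_det _).1 h)
  have h2 := congrFun h1 i
  ext j
  rw [← Matrix.one_eq_pi_single, ← h1]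
  rfl

/-! ### Genericity, freeness and uniqueness of normal forms. -/

namespace PseudoFrame

variable (F : PseudoFrame d k)

open Classical in
/-- The label of the edge `{i, j}` of the tree, with a junk value if `i` and `j` are not adjacent. -/
def lab (i j : Fin (d + 1)) : Fin k :=
  if h : F.tree.Adj i j then F.label ⟨s(i, j), h⟩ else F.base 0

lemma lab_of_adj {i j : Fin (d + 1)} (h : F.tree.Adj i j) : F.lab i j = F.label ⟨s(i, j), h⟩ :=
  dif_pos h

lemma lab_symm {i j : Fin (d + 1)} (h : F.tree.Adj i j) : F.lab j i = F.lab i j := by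
  rw [F.lab_of_adj h, F.lab_of_adj h.symm]
  congr 2
  exact Sym2.eq_swap

/-- The landmarks `b 0, …, b d` of `X` are in general position, and the coordinates at the ends of
the labelled edges of the tree do not vanish. -/
structure Generic (X : Matrix (Fin k) (Fin (d + 1)) ℝ) : Prop where
  isUnit : IsUnit (X.submatrix F.base id)
  ne_zero : ∀ (e : F.tree.edgeSet), ∀ v ∈ e.1, relCoord F.base X (F.label e) v ≠ 0

/-- A generic matrix with non-zero pivot coordinates. -/
structure PivotGeneric (c : Fin k → Fin (d + 1)) (X : Matrix (Fin k) (Fin (d + 1)) ℝ) : Prop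
    extends F.Generic X where
  pivot_ne_zero : ∀ l, l ∉ Set.range F.base → relCoord F.base X l (c l) ≠ 0

variable {F} {c : Fin k → Fin (d + 1)} {X Y : Matrix (Fin k) (Fin (d + 1)) ℝ}

lemma Generic.lab_ne_zero (h : F.Generic X) {i j : Fin (d + 1)} (hij : F.tree.Adj i j) :
    relCoord F.base X (F.lab i j) i ≠ 0 := by
  rw [F.lab_of_adj hij]
  exact h.ne_zero _ _ (Sym2.mem_mk_left _ _)

lemma Generic.of_rowColEquiv (h : F.Generic X) (hXY : RowColEquiv X Y) : F.Generic Y := by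
  obtain ⟨D, hD, B, rfl⟩ := hXY
  refine ⟨?_, fun e v hv => ?_⟩
  · rw [submatrix_diagonal_mul_mul]
    refine (IsUnit.mul ?_ h.isUnit).mul B.isUnit
    rw [isUnit_diagonal, Pi.isUnit_iff]
    exact fun i => (hD _).isUnit
  · rw [relCoord_diagonal_mul_mul _ hD]
    exact mul_ne_zero (mul_ne_zero (hD _) (h.ne_zero e v hv)) (inv_ne_zero (hD _))

lemma PivotGeneric.of_rowColEquiv (h : F.PivotGeneric c X) (hXY : RowColEquiv X Y) :
    F.PivotGeneric c Y := by
  refine ⟨h.toGeneric.of_rowColEquiv hXY, fun l hl => ?_⟩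
  obtain ⟨D, hD, B, rfl⟩ := hXY
  rw [relCoord_diagonal_mul_mul _ hD]
  exact mul_ne_zero (mul_ne_zero (hD _) (h.pivot_ne_zero l hl)) (inv_ne_zero (hD _))

lemma containedIn_iff {p : Config d k} : F.ContainedIn p ↔ F.Generic (homMatrix p) := by
  have h1 : Projectivization.Independent (fun i => p (F.base i)) ↔
      IsUnit ((homMatrix p).submatrix F.base id) := by
    rw [Projectivization.independent_iff, ← linearIndependent_rows_iff_isUnit]
    rfl
  constructor
  · rintro ⟨hi, h⟩
    refine ⟨h1.1 hi, ?_⟩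
    rintro ⟨e, he⟩ v hv
    induction e using Sym2.ind with | _ i j =>
    obtain ⟨-, -, h3, h4⟩ := h i j he
    rcases Sym2.mem_iff.1 hv with rfl | rfl
    · exact h3
    · exact h4
  · intro h
    refine ⟨h1.2 h.isUnit, fun i j hij => ⟨hij.ne, F.label_notMem _, ?_, ?_⟩⟩
    · exact h.ne_zero _ _ (Sym2.mem_mk_left _ _)
    · exact h.ne_zero _ _ (Sym2.mem_mk_right _ _)

lemma mem_chartDomain_iff {s : FreeShape d k} {X : HomCoord d k} (hX : X.shape = s.1) :
    s ∈ F.chartDomain c ↔ F.PivotGeneric c X.toMatrix := by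
  constructor
  · rintro ⟨p, hp, hF, hc⟩
    have : F.PivotGeneric c (rep p).toMatrix := ⟨containedIn_iff.1 hF, hc⟩
    exact this.of_rowColEquiv ((HomCoord.shape_eq_iff _ _).1 (by rw [shape_rep, hp, hX]))
  · intro h
    have : F.PivotGeneric c (rep X.config).toMatrix :=
      h.of_rowColEquiv ((HomCoord.shape_eq_iff _ _).1 (by rw [shape_rep]; rfl))
    exact ⟨X.config, hX, containedIn_iff.2 this.toGeneric, this.pivot_ne_zero⟩

lemma eq_of_tree_adj {α : Type*} (f : Fin (d + 1) → α) (h : ∀ i j, F.tree.Adj i j → f i = f j)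
    (i j : Fin (d + 1)) : f i = f j := by
  obtain ⟨w⟩ := F.isTree.connected.preconnected i j
  induction w with
  | nil => rfl
  | cons hij _ ih => exact (h _ _ hij).trans ih

/-- In relative coordinates g becomes diagonal with entries `D (F.base i)`. The label of an edge is
an eigenvector with non-zero coordinates at both ends, so these two entries agree; connectedness of
the tree makes g scalar. -/
lemma Generic.isFree {X : HomCoord d k} (h : F.Generic X.toMatrix) : IsFree X.config := by
  rw [HomCoord.isFree_iff]
  intro g D hD
  set M := X.toMatrix
  set P := M.submatrix F.base id with hP
  have hu := (isUnit_iff_isUnit_det _).1 h.isUnit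
  have h1 : diagonal (D ∘ F.base) * P = P * g.1 := by
    have := congrArg (fun N => N.submatrix F.base id) hD
    ext i j
    have := congrFun (congrFun this i) j
    simpa [Matrix.mul_apply, diagonal_apply, hP] using this
  have h2 : diagonal D * relCoord F.base M = relCoord F.base M * diagonal (D ∘ F.base) := by
    have h3 : diagonal (D ∘ F.base) = P * g.1 * P⁻¹ := by
      rw [← h1, Matrix.mul_assoc, Matrix.mul_nonsing_inv _ hu, Matrix.mul_one]
    rw [h3, ← Matrix.mul_assoc, ← Matrix.mul_assoc, relCoord_mul_base h.isUnit, ← hD, relCoord,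
      Matrix.mul_assoc]
  have h4 : ∀ l i, relCoord F.base M l i ≠ 0 → D (F.base i) = D l := by
    intro l i hne
    have := congrFun (congrFun h2 l) i
    rw [diagonal_mul, mul_diagonal, mul_comm] at this
    exact (mul_left_cancel₀ hne this).symm
  have h5 := fun i => F.eq_of_tree_adj (fun i => D (F.base i)) (fun i j hij =>
    (h4 _ i (h.lab_ne_zero hij)).trans
      (h4 _ j (by rw [← F.lab_symm hij]; exact h.lab_ne_zero hij.symm)).symm) i 0
  refine ⟨D (F.base 0), ?_⟩
  have h6 : diagonal (D ∘ F.base) = Matrix.scalar (Fin (d + 1)) (D (F.base 0)) := by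
    rw [Matrix.scalar_apply]; congr 1; funext i; exact h5 i
  rw [h6, (Matrix.scalar_commute _ (fun r => Commute.all _ r) P).eq] at h1
  exact IsUnit.mul_left_cancel h.isUnit h1

lemma IsNormalForm.submatrix_base (h : F.IsNormalForm c X) : X.submatrix F.base id = 1 := by
  ext i j
  rw [submatrix_apply, h.base_row, Matrix.one_eq_pi_single]
  rfl

lemma IsNormalForm.relCoord_eq (h : F.IsNormalForm c X) : relCoord F.base X = X := by
  rw [relCoord, h.submatrix_base]; simp

lemma IsNormalForm.row_ne_zero (h : F.IsNormalForm c X) (l : Fin k) : X l ≠ 0 := by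
  intro h0
  by_cases hl : l ∈ Set.range F.base
  · obtain ⟨i, rfl⟩ := hl
    have := congrFun (h.base_row i) i
    simp [h0] at this
  · have := h.pivot l hl
    simp [h0] at this

lemma IsNormalForm.pivotGeneric_iff (h : F.IsNormalForm c X) :
    F.PivotGeneric c X ↔ ∀ (e : F.tree.edgeSet), ∀ v ∈ e.1, X (F.label e) v ≠ 0 := by
  refine ⟨fun hX => ?_, fun hX => ⟨⟨?_, ?_⟩, ?_⟩⟩
  · simpa only [h.relCoord_eq] using hX.ne_zero
  · rw [h.submatrix_base]; exact isUnit_one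
  · simpa only [h.relCoord_eq] using hX
  · intro l hl
    rw [h.relCoord_eq, h.pivot l hl]
    exact one_ne_zero

/-- The edge equations make the column factors equal along the tree, hence all equal. The pivot
entries, which are 1 on both sides, then force each row factor to cancel this common value. -/
lemma IsNormalForm.eq_of_rowColEquiv (hX : F.IsNormalForm c X) (hY : F.IsNormalForm c Y)
    (hg : F.PivotGeneric c X) (h : RowColEquiv X Y) : X = Y := by
  obtain ⟨D, hD, B, hB⟩ := h
  have h1 : ∀ l j, Y l j = D l * X l j * (D (F.base j))⁻¹ := by
    intro l j
    have := relCoord_diagonal_mul_mul F.base hD X B l j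
    rwa [← hB, hY.relCoord_eq, hX.relCoord_eq] at this
  have h2 := hX.pivotGeneric_iff.1 hg
  have h3 := fun i => F.eq_of_tree_adj (fun i => (D (F.base i))⁻¹) (fun i j hij => by
    have h4 := hY.edge i j hij
    rw [h1, h1, hX.edge i j hij] at h4
    exact mul_left_cancel₀ (mul_ne_zero (hD _) (h2 _ _ (Sym2.mem_mk_right _ _))) h4) i 0
  ext l j
  by_cases hl : l ∈ Set.range F.base
  · obtain ⟨i, rfl⟩ := hl
    rw [hX.base_row, hY.base_row]
  · have h5 := h1 l (c l)
    rw [hY.pivot l hl, hX.pivot l hl, h3 (c l)] at h5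
    rw [h1, h3 j, mul_right_comm, ← mul_one (D l), ← h5, one_mul]

end PseudoFrame

/-! ### Existence of normal forms. -/

/-- The product of the ratios `u a b / u b a` over the darts `(a, b)` of a walk. -/
def walkRatio {V : Type*} {G : SimpleGraph V} (u : V → V → ℝ) : ∀ {a b : V}, G.Walk a b → ℝ
  | _, _, .nil => 1
  | a, _, .cons (v := v) _ p => u a v / u v a * walkRatio u p

lemma walkRatio_concat {V : Type*} {G : SimpleGraph V} (u : V → V → ℝ) {a b c : V}
    (p : G.Walk a b) (h : G.Adj b c) :
    walkRatio u (p.concat h) = walkRatio u p * (u b c / u c b) := by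
  induction p with
  | nil => simp [SimpleGraph.Walk.concat_nil, walkRatio]
  | cons _ _ ih => rw [SimpleGraph.Walk.concat_cons, walkRatio, walkRatio, ih, mul_assoc]

lemma walkRatio_ne_zero {V : Type*} {G : SimpleGraph V} {u : V → V → ℝ}
    (hu : ∀ a b, G.Adj a b → u a b ≠ 0) {a b : V} (p : G.Walk a b) : walkRatio u p ≠ 0 := by
  induction p with
  | nil => exact one_ne_zero
  | cons h _ ih => exact mul_ne_zero (div_ne_zero (hu _ _ h) (hu _ _ h.symm)) ih

lemma contDiffOn_walkRatio {V E : Type*} [NormedAddCommGroup E] [NormedSpace ℝ E]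
    {G : SimpleGraph V} {u : E → V → V → ℝ} {s : Set E} {n : WithTop ℕ∞}
    (hu : ∀ a b, G.Adj a b → ContDiffOn ℝ n (fun x => u x a b) s)
    (h0 : ∀ a b, G.Adj a b → ∀ x ∈ s, u x a b ≠ 0) {a b : V} (p : G.Walk a b) :
    ContDiffOn ℝ n (fun x => walkRatio (u x) p) s := by
  induction p with
  | nil => exact contDiffOn_const
  | cons h _ ih => exact ((hu _ _ h).div (hu _ _ h.symm) (h0 _ _ h.symm)).mul ih

namespace PseudoFrame

variable (F : PseudoFrame d k) (c : Fin k → Fin (d + 1)) (X : Matrix (Fin k) (Fin (d + 1)) ℝ)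

/-- The path in the tree from `0` to `j`. -/
def treePath (j : Fin (d + 1)) : F.tree.Walk 0 j := (F.isTree.existsUnique_path 0 j).choose

lemma isPath_treePath (j : Fin (d + 1)) : (F.treePath j).IsPath :=
  (F.isTree.existsUnique_path 0 j).choose_spec.1

/-- The factors by which the columns of the relative coordinates have to be multiplied in order
to make the coordinates of the labels agree at both ends of the edges of the tree. -/
def scale (j : Fin (d + 1)) : ℝ :=
  walkRatio (fun i j => relCoord F.base X (F.lab i j) i) (F.treePath j)

open Classical in
/-- The extension of the pivot `c` by `b i ↦ i`. -/
def extPivot (l : Fin k) : Fin (d + 1) := if h : ∃ i, F.base i = l then h.choose else c l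

@[simp] lemma extPivot_base (i : Fin (d + 1)) : F.extPivot c (F.base i) = i := by
  have h : ∃ j, F.base j = F.base i := ⟨i, rfl⟩
  rw [extPivot, dif_pos h]
  exact F.base.injective h.choose_spec

lemma extPivot_of_notMem {l : Fin k} (hl : l ∉ Set.range F.base) : F.extPivot c l = c l :=
  dif_neg hl

/-- The normal form of `X`. -/
def normalize : Matrix (Fin k) (Fin (d + 1)) ℝ := Matrix.of fun l j =>
  relCoord F.base X l j * F.scale X j /
    (relCoord F.base X l (F.extPivot c l) * F.scale X (F.extPivot c l))

variable {F c X}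

lemma Generic.scale_ne_zero (h : F.Generic X) (j : Fin (d + 1)) : F.scale X j ≠ 0 :=
  walkRatio_ne_zero (fun _ _ hij => h.lab_ne_zero hij) _

/-- In a tree, one end of an edge lies on the path from 0 to the other end, so the latter path is
the path to the former followed by this edge. The two scales thus differ by exactly the ratio that
balances the label's coordinates. -/
lemma Generic.scale_adj (h : F.Generic X) {i j : Fin (d + 1)} (hij : F.tree.Adj i j) :
    relCoord F.base X (F.lab i j) i * F.scale X i =
      relCoord F.base X (F.lab i j) j * F.scale X j := by
  have key : ∀ {i j : Fin (d + 1)} (hij : F.tree.Adj i j), i ∈ (F.treePath j).support →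
      relCoord F.base X (F.lab i j) i * F.scale X i =
        relCoord F.base X (F.lab i j) j * F.scale X j := by
    intro i j hij hi
    have h1 := F.isTree.isAcyclic.path_concat (F.isPath_treePath i) (F.isPath_treePath j) hij hi
    have h2 := h.lab_ne_zero hij.symm
    rw [F.lab_symm hij] at h2
    rw [scale, scale, h1, walkRatio_concat, F.lab_symm hij]
    field_simp
  by_cases hi : i ∈ (F.treePath j).support
  · exact key hij hi
  · have := key hij.symm (F.isTree.isAcyclic.mem_support_of_ne_mem_support_of_adj_of_isPath
      (F.isPath_treePath i) (F.isPath_treePath j) hij hi)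
    rw [F.lab_symm hij] at this
    exact this.symm

lemma PivotGeneric.extPivot_ne_zero (h : F.PivotGeneric c X) (l : Fin k) :
    relCoord F.base X l (F.extPivot c l) ≠ 0 := by
  by_cases hl : l ∈ Set.range F.base
  · obtain ⟨i, rfl⟩ := hl
    rw [extPivot_base, relCoord_base h.isUnit]
    simp
  · rw [F.extPivot_of_notMem c hl]
    exact h.pivot_ne_zero l hl

lemma PivotGeneric.isNormalForm_normalize (h : F.PivotGeneric c X) :
    F.IsNormalForm c (F.normalize c X) where
  base_row i := by
    ext j
    have := h.scale_ne_zero i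
    -- The extended pivot divides row `F.base i` by its own scale i, so the unit vector survives the
    -- column scaling.
    rw [normalize, of_apply, extPivot_base, relCoord_base h.isUnit]
    by_cases hij : j = i
    · subst hij; simp [this]
    · simp [hij]
  edge i j hij := by
    rw [normalize, of_apply, of_apply, ← F.lab_of_adj hij, h.scale_adj hij]
  pivot l hl := by
    rw [normalize, of_apply, F.extPivot_of_notMem c hl]
    exact div_self (mul_ne_zero (h.pivot_ne_zero l hl) (h.scale_ne_zero _))

lemma PivotGeneric.rowColEquiv_normalize (h : F.PivotGeneric c X) :
    RowColEquiv X (F.normalize c X) := by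
  have h1 : IsUnit (X.submatrix F.base id)⁻¹ := by
    rw [Matrix.isUnit_nonsing_inv_iff]; exact h.isUnit
  have h2 : IsUnit (diagonal (F.scale X)) := by
    rw [isUnit_diagonal, Pi.isUnit_iff]
    exact fun i => (h.scale_ne_zero i).isUnit
  refine ⟨fun l => (relCoord F.base X l (F.extPivot c l) * F.scale X (F.extPivot c l))⁻¹,
    fun l => inv_ne_zero (mul_ne_zero (h.extPivot_ne_zero l) (h.scale_ne_zero _)),
    (h1.mul h2).unit, ?_⟩
  ext l j
  rw [IsUnit.unit_spec, ← Matrix.mul_assoc, Matrix.mul_assoc (diagonal _), mul_diagonal,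
    diagonal_mul, normalize, of_apply, relCoord]
  ring

lemma PivotGeneric.represents_normalize {X : HomCoord d k} (h : F.PivotGeneric c X.toMatrix) :
    Represents (F.normalize c X.toMatrix) X.shape := by
  have h1 := h.isNormalForm_normalize.row_ne_zero
  exact represents_iff.2 ⟨fun l => ⟨_, h1 l⟩, rfl,
    ((HomCoord.shape_eq_iff _ _).2 h.rowColEquiv_normalize).symm⟩

/-- A matrix in normal form that represents a shape is unique. -/
lemma PivotGeneric.eq_normalize {X : HomCoord d k} (h : F.PivotGeneric c X.toMatrix)
    {Y : Matrix (Fin k) (Fin (d + 1)) ℝ} (hY : F.IsNormalForm c Y) (hr : Represents Y X.shape) :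
    Y = F.normalize c X.toMatrix := by
  obtain ⟨Z, rfl, hZ⟩ := represents_iff.1 hr
  have h1 : F.PivotGeneric c Z.toMatrix :=
    h.of_rowColEquiv ((HomCoord.shape_eq_iff _ _).1 hZ.symm)
  obtain ⟨W, hW, hWs⟩ := represents_iff.1 h.represents_normalize
  refine hY.eq_of_rowColEquiv h.isNormalForm_normalize h1 ?_
  rw [← hW, ← HomCoord.shape_eq_iff, hZ, hWs]

end PseudoFrame

/-! ### Smoothness of normalisation. -/

section Smooth

variable {E : Type*} [NormedAddCommGroup E] [NormedSpace ℝ E] {s : Set E} {n : WithTop ℕ∞}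

lemma contDiffOn_det {m : ℕ} {M : E → Matrix (Fin m) (Fin m) ℝ}
    (hM : ∀ i j, ContDiffOn ℝ n (fun x => M x i j) s) :
    ContDiffOn ℝ n (fun x => (M x).det) s := by
  simp only [Matrix.det_apply']
  exact ContDiffOn.sum fun σ _ => contDiffOn_const.mul (contDiffOn_prod fun i _ => hM _ _)

/-- Cramer's rule: each entry of the inverse is a quotient of determinants. -/
lemma contDiffOn_inv_apply {m : ℕ} {M : E → Matrix (Fin m) (Fin m) ℝ}
    (hM : ∀ i j, ContDiffOn ℝ n (fun x => M x i j) s) (hu : ∀ x ∈ s, IsUnit (M x))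
    (i j : Fin m) : ContDiffOn ℝ n (fun x => (M x)⁻¹ i j) s := by
  simp only [Matrix.inv_def, Matrix.smul_apply, Ring.inverse_eq_inv', smul_eq_mul,
    Matrix.adjugate_apply]
  refine ((contDiffOn_det hM).inv fun x hx => ?_).mul (contDiffOn_det fun a b => ?_)
  · exact ((isUnit_iff_isUnit_det _).1 (hu x hx)).ne_zero
  · simp only [Matrix.updateRow_apply]
    split_ifs
    · exact contDiffOn_const
    · exact hM a b

lemma contDiffOn_relCoord {b : Fin (d + 1) ↪ Fin k} {M : E → Matrix (Fin k) (Fin (d + 1)) ℝ}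
    (hM : ∀ i j, ContDiffOn ℝ n (fun x => M x i j) s)
    (hu : ∀ x ∈ s, IsUnit ((M x).submatrix b id)) (l : Fin k) (j : Fin (d + 1)) :
    ContDiffOn ℝ n (fun x => relCoord b (M x) l j) s := by
  simp only [relCoord, Matrix.mul_apply]
  exact ContDiffOn.sum fun i _ => (hM _ _).mul (contDiffOn_inv_apply (fun _ _ => hM _ _) hu _ _)

lemma PseudoFrame.contDiffOn_normalize {F : PseudoFrame d k} {c : Fin k → Fin (d + 1)}
    {M : E → Matrix (Fin k) (Fin (d + 1)) ℝ} (hM : ∀ i j, ContDiffOn ℝ n (fun x => M x i j) s)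
    (hs : ∀ x ∈ s, F.PivotGeneric c (M x)) (l : Fin k) (j : Fin (d + 1)) :
    ContDiffOn ℝ n (fun x => F.normalize c (M x) l j) s := by
  have h1 := contDiffOn_relCoord hM fun x hx => (hs x hx).isUnit
  have h2 : ∀ j, ContDiffOn ℝ n (fun x => F.scale (M x) j) s := fun j =>
    contDiffOn_walkRatio (fun _ _ _ => h1 _ _) (fun _ _ hij x hx => (hs x hx).lab_ne_zero hij) _
  exact ((h1 l j).mul (h2 j)).div ((h1 l _).mul (h2 _)) fun x hx =>
    mul_ne_zero ((hs x hx).extPivot_ne_zero l) ((hs x hx).scale_ne_zero _)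

end Smooth

/-! ### Every free configuration contains a pseudo-frame. -/

/-- If φ annihilates all landmarks and w is one of them, the transvection 1 + φ w fixes every row;
freeness makes it scalar, so φ w = 0. -/
lemma eq_zero_of_isFree_of_mulVec_eq_zero (hk : 0 < k) {X : HomCoord d k} (h : IsFree X.config)
    {φ : Fin (d + 1) → ℝ} (hφ : X.toMatrix *ᵥ φ = 0) : φ = 0 := by
  rw [HomCoord.isFree_iff] at h
  set w : Fin (d + 1) → ℝ := X.toMatrix ⟨0, hk⟩ with hw
  have hw0 : w ≠ 0 := (X _).2
  have hwφ : w ⬝ᵥ φ = 0 := congrFun hφ ⟨0, hk⟩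
  have hsq : vecMulVec φ w * vecMulVec φ w = 0 := by
    rw [vecMulVec_mul_vecMulVec, hwφ]; simp
  have hX : X.toMatrix * vecMulVec φ w = 0 := by
    rw [mul_vecMulVec, hφ]; simp
  let g : GL (Fin (d + 1)) ℝ := ⟨1 + vecMulVec φ w, 1 - vecMulVec φ w, by
    simp [mul_sub, add_mul, hsq], by simp [sub_mul, mul_add, hsq]⟩
  obtain ⟨a, ha⟩ := h g (fun _ => 1) (by
    change _ = X.toMatrix * (1 + vecMulVec φ w)
    rw [Matrix.mul_add, hX]; simp)
  have ha' : Matrix.scalar (Fin (d + 1)) a = 1 + vecMulVec φ w := ha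
  -- Since w ⬝ φ = 0, the transvection fixes w, which identifies the scalar as 1.
  have h1 : a • w = w := by
    have h2 := congrArg (fun M => w ᵥ* M) ha'
    simpa [vecMul_add, vecMul_vecMulVec, hwφ, Matrix.scalar_apply, vecMul_diagonal,
      ← smul_one_eq_diagonal, vecMul_smul] using h2
  have h3 : a = 1 := by
    by_contra hne
    have : (a - 1) • w = 0 := by rw [sub_smul, h1, one_smul, sub_self]
    exact hw0 ((smul_eq_zero.1 this).resolve_left (sub_ne_zero.2 hne))
  have h4 : vecMulVec φ w = 0 := by
    rw [h3, map_one] at ha'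
    simpa using ha'.symm
  by_contra hne
  obtain ⟨i, hi⟩ := Function.ne_iff.1 hne
  obtain ⟨j, hj⟩ := Function.ne_iff.1 hw0
  have := congrFun (congrFun h4 i) j
  rw [vecMulVec_apply] at this
  exact (mul_ne_zero hi hj) this

/-- A functional that vanishes on all rows is zero by the previous lemma, so the rows span and
contain a basis. -/
lemma exists_base_of_isFree (hk : 0 < k) {X : HomCoord d k} (h : IsFree X.config) :
    ∃ b : Fin (d + 1) ↪ Fin k, IsUnit (X.toMatrix.submatrix b id) := by
  have hspan : Submodule.span ℝ (Set.range X.toMatrix) = ⊤ := by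
    by_contra hne
    obtain ⟨f, hf0, hf⟩ := Submodule.exists_le_ker_of_lt_top _ (lt_top_iff_ne_top.2 hne)
    refine hf0 ?_
    have h1 : ∀ v, f v = v ⬝ᵥ fun i => f (Pi.single i 1) := by
      intro v
      conv_lhs => rw [← Finset.univ_sum_single v, map_sum]
      refine Finset.sum_congr rfl fun i _ => ?_
      have h2 : Pi.single i (v i) = v i • (Pi.single i 1 : Fin (d + 1) → ℝ) := by
        rw [← Pi.single_smul, smul_eq_mul, mul_one]
      rw [h2, map_smul]
      rfl
    have h2 := eq_zero_of_isFree_of_mulVec_eq_zero hk h (φ := fun i => f (Pi.single i 1)) (by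
      funext l
      exact (h1 _).symm.trans (hf (Submodule.subset_span ⟨l, rfl⟩)))
    ext v
    simpa using congrFun h2 v
  obtain ⟨κ, a, ha, hs, hli⟩ := exists_linearIndependent' ℝ X.toMatrix
  rw [hspan] at hs
  let B := Module.Basis.mk hli hs.ge
  have e : κ ≃ Fin (d + 1) := B.indexEquiv (Pi.basisFun ℝ (Fin (d + 1)))
  refine ⟨⟨a ∘ e.symm, ha.comp e.symm.injective⟩, ?_⟩
  rw [← linearIndependent_rows_iff_isUnit]
  exact hli.comp _ e.symm.injective

/-- The graph on the landmarks `b 0, …, b d` in which `i` and `j` are adjacent if some other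
landmark has non-zero `i`-th and `j`-th coordinates. -/
def coordGraph (b : Fin (d + 1) ↪ Fin k) (X : Matrix (Fin k) (Fin (d + 1)) ℝ) :
    SimpleGraph (Fin (d + 1)) where
  Adj i j := i ≠ j ∧ ∃ l ∉ Set.range b, relCoord b X l i ≠ 0 ∧ relCoord b X l j ≠ 0
  symm := ⟨fun _ _ h => ⟨h.1.symm, h.2.imp fun _ hl => ⟨hl.1, hl.2.2, hl.2.1⟩⟩⟩
  loopless := ⟨fun _ h => h.1 rfl⟩

/-- Each row of relative coordinates is supported in one component. A diagonal matrix that is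
constant on components therefore has every row as an eigenvector, and freeness makes it scalar. -/
lemma connected_coordGraph {X : HomCoord d k} (h : IsFree X.config) {b : Fin (d + 1) ↪ Fin k}
    (hb : IsUnit (X.toMatrix.submatrix b id)) : (coordGraph b X.toMatrix).Connected := by
  classical
  rw [HomCoord.isFree_iff] at h
  set C := relCoord b X.toMatrix with hC
  set P := X.toMatrix.submatrix b id with hP
  have hCP : C * P = X.toMatrix := relCoord_mul_base hb
  have hdet := (isUnit_iff_isUnit_det _).1 hb
  have hreach : ∀ l i j, C l i ≠ 0 → C l j ≠ 0 →
      (coordGraph b X.toMatrix).Reachable i j := by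
    intro l i j hi hj
    by_cases hij : i = j
    · rw [hij]
    · refine SimpleGraph.Adj.reachable ⟨hij, l, ?_, hi, hj⟩
      -- A base landmark has a single non-zero coordinate, so it cannot link two distinct vertices.
      rintro ⟨m, rfl⟩
      rw [hC, relCoord_base hb] at hi hj
      have h1 : i = m := by by_contra hne; simp [hne] at hi
      have h2 : j = m := by by_contra hne; simp [hne] at hj
      exact hij (h1.trans h2.symm)
  rw [SimpleGraph.connected_iff]
  refine ⟨fun i₀ => ?_, inferInstance⟩
  -- Any two distinct non-zero values would do.
  let E : Fin (d + 1) → ℝ := fun i => if (coordGraph b X.toMatrix).Reachable i₀ i then 1 else 2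
  have hE : ∀ i, E i ≠ 0 := by intro i; simp only [E]; split_ifs <;> norm_num
  have hD : ∀ l, ∃ a : ℝ, ∀ i, a * C l i = C l i * E i := by
    intro l
    by_cases hl : ∃ i, C l i ≠ 0
    · obtain ⟨i, hi⟩ := hl
      refine ⟨E i, fun j => ?_⟩
      by_cases hj : C l j = 0
      · simp [hj]
      · have h1 := hreach l i j hi hj
        have h2 : E i = E j := by
          simp only [E]
          congr 1
          exact propext ⟨fun h => h.trans h1, fun h => h.trans h1.symm⟩
        rw [h2, mul_comm]
    · push Not at hl
      exact ⟨0, fun i => by simp [hl]⟩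
  choose D hD using hD
  have hDC : diagonal D * C = C * diagonal E := by
    ext l i
    rw [diagonal_mul, mul_diagonal, hD]
  have hEu : IsUnit (diagonal E) := by
    rw [isUnit_diagonal, Pi.isUnit_iff]; exact fun i => (hE i).isUnit
  have hPu : IsUnit P⁻¹ := by rw [Matrix.isUnit_nonsing_inv_iff]; exact hb
  obtain ⟨a, ha⟩ := h ((hPu.mul hEu).mul hb).unit D (by
    rw [IsUnit.unit_spec, ← hCP, ← Matrix.mul_assoc, hDC]
    calc _ = C * (1 * diagonal E * P) := by rw [Matrix.one_mul, Matrix.mul_assoc]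
      _ = _ := by rw [← Matrix.mul_nonsing_inv P hdet]; simp only [Matrix.mul_assoc])
  rw [IsUnit.unit_spec] at ha
  have hEa : diagonal E = Matrix.scalar (Fin (d + 1)) a := by
    calc diagonal E = (P * P⁻¹) * diagonal E * (P * P⁻¹) := by
          rw [Matrix.mul_nonsing_inv P hdet]; simp
      _ = P * (P⁻¹ * diagonal E * P) * P⁻¹ := by simp only [Matrix.mul_assoc]
      _ = _ := by
        rw [← ha, ← (Matrix.scalar_commute _ (fun r => Commute.all _ r) P).eq, Matrix.mul_assoc,
          Matrix.mul_nonsing_inv P hdet, Matrix.mul_one]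
  have hEa' : ∀ i, E i = a := fun i => by
    have := congrFun (congrFun hEa i) i
    simpa using this
  intro j
  by_contra hj
  have h1 : E i₀ = 1 := if_pos (SimpleGraph.Reachable.refl _)
  have h2 : E j = 2 := if_neg hj
  rw [hEa'] at h1 h2
  linarith

/-- The pseudo-frame is a spanning tree of the coordinate graph, with a witnessing landmark chosen
for each edge. -/
lemma exists_generic_of_isFree (hk : 0 < k) {X : HomCoord d k} (h : IsFree X.config) :
    ∃ F : PseudoFrame d k, F.Generic X.toMatrix := by
  obtain ⟨b, hb⟩ := exists_base_of_isFree hk h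
  obtain ⟨T, hT, hTree⟩ := (connected_coordGraph h hb).exists_isTree_le
  have hl : ∀ e : T.edgeSet, ∃ l ∉ Set.range b, ∀ v ∈ e.1, relCoord b X.toMatrix l v ≠ 0 := by
    rintro ⟨e, he⟩
    induction e using Sym2.ind with | _ i j =>
    obtain ⟨-, l, hl, hi, hj⟩ := hT he
    refine ⟨l, hl, fun v hv => ?_⟩
    rcases Sym2.mem_iff.1 hv with rfl | rfl
    · exact hi
    · exact hj
  choose lab hlab hlab' using hl
  exact ⟨⟨b, T, hTree, lab, hlab⟩, hb, hlab'⟩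

/-- A label takes its pivot at an end of one of its edges; any other landmark has some non-zero
coordinate because its row is non-zero. -/
lemma PseudoFrame.Generic.exists_pivot {F : PseudoFrame d k} {X : HomCoord d k}
    (h : F.Generic X.toMatrix) : ∃ c, F.IsPivot c ∧ F.PivotGeneric c X.toMatrix := by
  have hc : ∀ l, ∃ i, relCoord F.base X.toMatrix l i ≠ 0 ∧
      ∀ e, F.label e = l → ∃ e', F.label e' = l ∧ i ∈ e'.1 := by
    intro l
    by_cases hl : ∃ e, F.label e = l
    · obtain ⟨e, rfl⟩ := hl
      have h1 : e.1.out.1 ∈ e.1 := Sym2.out_fst_mem _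
      exact ⟨e.1.out.1, h.ne_zero e _ h1, fun _ _ => ⟨e, rfl, h1⟩⟩
    · have h1 : ∃ i, relCoord F.base X.toMatrix l i ≠ 0 := by
        by_contra hne
        push Not at hne
        refine (X l).2 ?_
        funext j
        change X.toMatrix l j = 0
        rw [← relCoord_mul_base h.isUnit, Matrix.mul_apply]
        simp [hne]
      obtain ⟨i, hi⟩ := h1
      exact ⟨i, hi, fun e he => absurd ⟨e, he⟩ hl⟩
  choose c hc1 hc2 using hc
  exact ⟨c, fun e => hc2 _ e rfl, h, fun l _ => hc1 l⟩

lemma exists_mem_chartDomain (hk : 0 < k) (s : FreeShape d k) :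
    ∃ (F : PseudoFrame d k) (c : Fin k → Fin (d + 1)), F.IsPivot c ∧ s ∈ F.chartDomain c := by
  obtain ⟨p, hp, hs⟩ := s.2
  obtain ⟨F, hF⟩ := exists_generic_of_isFree hk (X := rep p) (by simpa using hp)
  obtain ⟨c, hc, hg⟩ := hF.exists_pivot
  exact ⟨F, c, hc, (PseudoFrame.mem_chartDomain_iff (by rw [shape_rep, hs])).2 hg⟩

/-! ### The affine space of normal forms. -/

namespace PseudoFrame

variable (F : PseudoFrame d k) (c : Fin k → Fin (d + 1))

/-- The coboundary of the tree: the differences of a function on the vertices along the edges. -/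
def coboundary : (Fin (d + 1) → ℝ) →ₗ[ℝ] (F.tree.edgeSet → ℝ) where
  toFun x e := x e.1.out.1 - x e.1.out.2
  map_add' x y := by ext e; simp only [Pi.add_apply]; ring
  map_smul' a x := by ext e; simp only [Pi.smul_apply, smul_eq_mul, RingHom.id_apply]; ring

variable {F} in
lemma eq_of_out_eq {x : Fin (d + 1) → ℝ} {e : F.tree.edgeSet} (h : x e.1.out.1 = x e.1.out.2)
    {i j : Fin (d + 1)} (he : e.1 = s(i, j)) : x i = x j := by
  have h1 : s(e.1.out.1, e.1.out.2) = s(i, j) := by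
    rw [← he]; exact Quot.out_eq e.1
  rcases Sym2.eq_iff.1 h1 with ⟨h2, h3⟩ | ⟨h2, h3⟩
  · rw [← h2, ← h3, h]
  · rw [← h2, ← h3, h]

lemma card_edgeSet : Nat.card F.tree.edgeSet = d := by
  classical
  have h := F.isTree.card_edgeFinset
  rw [Fintype.card_fin, ← SimpleGraph.card_edgeSet] at h
  rw [Nat.card_eq_fintype_card]
  omega

/-- The kernel consists of constants, and a tree has one edge fewer than vertices; rank-nullity does
the rest. -/
lemma surjective_coboundary : Function.Surjective F.coboundary := by
  classical
  have hker : F.coboundary.ker ≤ Submodule.span ℝ {fun _ => 1} := by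
    intro x hx
    have h1 := fun i => F.eq_of_tree_adj x (fun i j hij =>
      eq_of_out_eq (e := ⟨s(i, j), hij⟩) (sub_eq_zero.1 (congrFun hx _)) rfl) i 0
    refine Submodule.mem_span_singleton.2 ⟨x 0, ?_⟩
    funext i
    simp [h1 i]
  have h2 := (Submodule.finrank_mono hker).trans (finrank_span_le_card _)
  rw [Set.toFinset_singleton, Finset.card_singleton] at h2
  have h3 := F.coboundary.finrank_range_add_finrank_ker
  rw [Module.finrank_fin_fun] at h3
  rw [← LinearMap.range_eq_top]
  refine Submodule.eq_top_of_finrank_eq (le_antisymm (Submodule.finrank_le _) ?_)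
  rw [Module.finrank_fintype_fun_eq_card, ← Nat.card_eq_fintype_card, F.card_edgeSet]
  omega

/-- The linear part of the equations that define the normal form. -/
def normalFormEquations : Matrix (Fin k) (Fin (d + 1)) ℝ →ₗ[ℝ]
    (Fin (d + 1) → Fin (d + 1) → ℝ) × (F.tree.edgeSet → ℝ) ×
      ({l // l ∉ Set.range F.base} → ℝ) where
  toFun X := (fun i => X (F.base i),
    fun e => X (F.label e) e.1.out.1 - X (F.label e) e.1.out.2, fun l => X l.1 (c l.1))
  map_add' X Y := by
    ext <;> simp only [Prod.fst_add, Prod.snd_add, Pi.add_apply, Matrix.add_apply]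
    ring
  map_smul' a X := by
    ext <;> simp only [Prod.smul_fst, Prod.smul_snd, Pi.smul_apply, Matrix.smul_apply,
      smul_eq_mul, RingHom.id_apply]
    ring

lemma surjective_normalFormEquations : Function.Surjective (F.normalFormEquations c) := by
  classical
  rintro ⟨Y, a, r⟩
  -- The equations decouple by rows: row l must have prescribed differences only on the edges
  -- labelled l. Adding a constant then adjusts the pivot entry without changing differences.
  choose x hx using fun l => F.surjective_coboundary fun e => if F.label e = l then a e else 0
  refine ⟨Matrix.of fun l j => if h : l ∈ Set.range F.base then Y h.choose j
    else x l j - x l (c l) + r ⟨l, h⟩, Prod.ext ?_ (Prod.ext ?_ ?_)⟩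
  · funext i j
    have h : ∃ i', F.base i' = F.base i := ⟨i, rfl⟩
    have h1 : F.base i ∈ Set.range F.base := h
    change (if h : F.base i ∈ Set.range F.base then Y h.choose j else _) = Y i j
    rw [dif_pos h1, F.base.injective h1.choose_spec]
  · funext e
    have h1 := congrFun (hx (F.label e)) e
    simp only [if_true] at h1
    simp only [normalFormEquations, LinearMap.coe_mk, AddHom.coe_mk, of_apply,
      dif_neg (F.label_notMem e)]
    rw [← h1]
    simp only [coboundary, LinearMap.coe_mk, AddHom.coe_mk]
    ring
  · funext l
    simp only [normalFormEquations, LinearMap.coe_mk, AddHom.coe_mk, of_apply, dif_neg l.2]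
    ring

/-- The count is k(d + 1) − (d + 1)² − d − (k − d − 1) = d(k − d − 2). -/
lemma finrank_ker_normalFormEquations :
    Module.finrank ℝ (F.normalFormEquations c).ker = d * (k - d - 2) := by
  classical
  have h1 := (F.normalFormEquations c).finrank_range_add_finrank_ker
  rw [LinearMap.range_eq_top.2 (F.surjective_normalFormEquations c), finrank_top,
    Module.finrank_prod, Module.finrank_prod, Module.finrank_matrix, Module.finrank_pi_fintype,
    Module.finrank_fintype_fun_eq_card, Module.finrank_fintype_fun_eq_card,
    ← Nat.card_eq_fintype_card (α := F.tree.edgeSet), F.card_edgeSet] at h1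
  have h2 : Fintype.card {l // l ∉ Set.range F.base} = k - (d + 1) := by
    rw [Fintype.card_subtype_compl, Fintype.card_fin]
    congr 1
    have := Fintype.card_range F.base
    rw [Fintype.card_fin] at this
    convert this
  have h3 : d + 1 ≤ k := by simpa using Fintype.card_le_of_embedding F.base
  simp only [Finset.sum_const, Finset.card_univ, Fintype.card_fin,
    smul_eq_mul, Module.finrank_self, mul_one] at h1
  rw [Module.finrank_fintype_fun_eq_card, h2] at h1
  obtain ⟨m, rfl⟩ := Nat.exists_eq_add_of_le h3
  rcases m with _ | m
  -- Case k = d + 1, where the subtraction truncates: no landmark is left to label an edge, so d = 0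
  -- and both sides vanish.
  · simp only [Nat.add_zero, Nat.sub_self] at h1 ⊢
    have h4 : d + Module.finrank ℝ (F.normalFormEquations c).ker = 0 := by linarith
    rw [(Nat.add_eq_zero_iff.1 h4).2, (Nat.add_eq_zero_iff.1 h4).1, Nat.zero_mul]
  · have e1 : d + 1 + (m + 1) - (d + 1) = m + 1 := by omega
    have e2 : d + 1 + (m + 1) - d - 2 = m := by omega
    rw [e1] at h1
    rw [e2]
    nlinarith

variable {F c} in
lemma isNormalForm_iff {X : Matrix (Fin k) (Fin (d + 1)) ℝ} : F.IsNormalForm c X ↔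
    F.normalFormEquations c X = (fun i => Pi.single i 1, 0, fun _ => 1) := by
  constructor
  · intro h
    refine Prod.ext (funext h.base_row) (Prod.ext ?_ (funext fun l => h.pivot l.1 l.2))
    funext e
    have h1 : s(e.1.out.1, e.1.out.2) = e.1 := Quot.out_eq e.1
    have h2 : F.tree.Adj e.1.out.1 e.1.out.2 := by
      rw [← SimpleGraph.mem_edgeSet, h1]; exact e.2
    have h3 := h.edge _ _ h2
    have h4 : (⟨s(e.1.out.1, e.1.out.2), h2⟩ : F.tree.edgeSet) = e := Subtype.ext h1
    rw [h4] at h3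
    exact sub_eq_zero.2 h3
  · intro h
    exact ⟨fun i => congrFun (congrArg Prod.fst h) i,
      fun i j hij => eq_of_out_eq (e := ⟨s(i, j), hij⟩)
        (sub_eq_zero.1 (congrFun (congrArg (fun p => p.2.1) h) _)) rfl,
      fun l hl => congrFun (congrArg (fun p => p.2.2) h) ⟨l, hl⟩⟩

/-- The matrices in normal form are an affine space of dimension `d * (k - d - 2)`. -/
lemma exists_affineMap_range_eq :
    ∃ A : EuclideanSpace ℝ (Fin (d * (k - d - 2))) →ᵃ[ℝ] Matrix (Fin k) (Fin (d + 1)) ℝ,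
      Function.Injective A ∧ Set.range A = {X | F.IsNormalForm c X} := by
  obtain ⟨X₀, hX₀⟩ := F.surjective_normalFormEquations c (fun i => Pi.single i 1, 0, fun _ => 1)
  have hfr : Module.finrank ℝ (EuclideanSpace ℝ (Fin (d * (k - d - 2)))) =
      Module.finrank ℝ (F.normalFormEquations c).ker := by
    rw [finrank_euclideanSpace_fin, finrank_ker_normalFormEquations]
  let φ := LinearEquiv.ofFinrankEq _ _ hfr
  refine ⟨((Submodule.subtype _).comp φ.toLinearMap).toAffineMap + AffineMap.const ℝ _ X₀, ?_, ?_⟩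
  · intro x y hxy
    have : ((φ x : Matrix (Fin k) (Fin (d + 1)) ℝ)) + X₀ = φ y + X₀ := hxy
    exact φ.injective (Subtype.ext (add_right_cancel this))
  · ext X
    rw [Set.mem_ofPred_eq, isNormalForm_iff]
    constructor
    · rintro ⟨x, rfl⟩
      change F.normalFormEquations c ((φ x : Matrix (Fin k) (Fin (d + 1)) ℝ) + X₀) = _
      rw [map_add, hX₀, LinearMap.mem_ker.1 (φ x).2, zero_add]
    · intro h
      have h1 : X - X₀ ∈ (F.normalFormEquations c).ker := by
        rw [LinearMap.mem_ker, map_sub, h, hX₀, sub_self]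
      refine ⟨φ.symm ⟨_, h1⟩, ?_⟩
      change ((φ (φ.symm ⟨_, h1⟩) : Matrix (Fin k) (Fin (d + 1)) ℝ)) + X₀ = _
      rw [LinearEquiv.apply_symm_apply, sub_add_cancel]

end PseudoFrame

/-! ### Open domains, charts and transition maps. -/

lemma exists_contDiff_leftInverse {E : Type*} [NormedAddCommGroup E] [NormedSpace ℝ E]
    [FiniteDimensional ℝ E] {A : E →ᵃ[ℝ] Matrix (Fin k) (Fin (d + 1)) ℝ}
    (hA : Function.Injective A) :
    ∃ L : (Fin k → Fin (d + 1) → ℝ) → E, ContDiff ℝ ∞ L ∧ ∀ x, L (A x) = x := by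
  obtain ⟨g, hg⟩ := A.linear.exists_leftInverse_of_injective
    (LinearMap.ker_eq_bot.2 (A.linear_injective_iff.2 hA))
  let g' : (Fin k → Fin (d + 1) → ℝ) →ₗ[ℝ] E := g
  refine ⟨fun Y => g' Y - g (A 0), ?_, fun x => ?_⟩
  · exact (g'.toContinuousLinearMap.contDiff).sub contDiff_const
  · change g (A x) - g (A 0) = x
    rw [← map_sub, ← vsub_eq_sub, ← AffineMap.linearMap_vsub, vsub_eq_sub, sub_zero]
    exact LinearMap.congr_fun hg x

lemma contDiff_affineMap_apply {E : Type*} [NormedAddCommGroup E] [NormedSpace ℝ E]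
    [FiniteDimensional ℝ E] (A : E →ᵃ[ℝ] Matrix (Fin k) (Fin (d + 1)) ℝ) {n : WithTop ℕ∞}
    (l : Fin k) (j : Fin (d + 1)) : ContDiff ℝ n (fun x => A x l j) := by
  have h : (fun x => A x l j) = fun x =>
      ((Matrix.entryLinearMap ℝ ℝ l j ∘ₗ A.linear).toContinuousLinearMap x) + A 0 l j := by
    funext x
    exact congrFun (congrFun (congrFun (AffineMap.decomp A) x) l) j
  rw [h]
  exact (ContinuousLinearMap.contDiff _).add contDiff_const

lemma PseudoFrame.isOpen_pivotGeneric (F : PseudoFrame d k) (c : Fin k → Fin (d + 1)) :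
    IsOpen {Y : Fin k → Fin (d + 1) → ℝ | F.PivotGeneric c (Matrix.of Y)} := by
  have h1 : IsOpen {Y : Fin k → Fin (d + 1) → ℝ | IsUnit ((Matrix.of Y).submatrix F.base id)} := by
    simp only [isUnit_iff_isUnit_det, isUnit_iff_ne_zero]
    have h2 : Continuous fun Y : Fin k → Fin (d + 1) → ℝ =>
        ((Matrix.of Y).submatrix F.base id).det :=
      Continuous.matrix_det (continuous_matrix fun i j =>
        (continuous_apply j).comp (continuous_apply (F.base i)))
    exact isOpen_ne.preimage h2
  -- Relative coordinates are continuous where the base block is invertible. This set is open, so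
  -- the remaining conditions can be pulled back within it.
  have h3 : ContinuousOn (fun Y : Fin k → Fin (d + 1) → ℝ => fun l j =>
      relCoord F.base (Matrix.of Y) l j) {Y | IsUnit ((Matrix.of Y).submatrix F.base id)} := by
    refine continuousOn_pi.2 fun l => continuousOn_pi.2 fun j => ?_
    exact (contDiffOn_relCoord (n := 0) (fun i j => (contDiff_apply_apply ℝ ℝ i j).contDiffOn)
      (fun _ h => h) l j).continuousOn
  have h4 : IsOpen {C : Fin k → Fin (d + 1) → ℝ |
      (∀ (e : F.tree.edgeSet) (v : {v // v ∈ e.1}), C (F.label e) v ≠ 0) ∧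
        ∀ l : {l // l ∉ Set.range F.base}, C l (c l) ≠ 0} := by
    have h5 : ∀ l j, IsOpen {C : Fin k → Fin (d + 1) → ℝ | C l j ≠ 0} := fun l j =>
      isOpen_ne.preimage ((continuous_apply j).comp (continuous_apply l))
    simp only [Set.ofPred_and, Set.ofPred_forall]
    exact (isOpen_iInter_of_finite fun e => isOpen_iInter_of_finite fun v => h5 _ _).inter
      (isOpen_iInter_of_finite fun l => h5 _ _)
  convert h3.isOpen_inter_preimage h1 h4 using 1
  ext Y
  exact ⟨fun h => ⟨h.isUnit, fun e v => h.ne_zero e v v.2, fun l => h.pivot_ne_zero l l.2⟩,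
    fun h => ⟨⟨h.1, fun e v hv => h.2.1 e ⟨v, hv⟩⟩, fun l hl => h.2.2 ⟨l, hl⟩⟩⟩

lemma continuous_homCoord_val : Continuous
    (fun X : HomCoord d k => (X.toMatrix : Fin k → Fin (d + 1) → ℝ)) :=
  continuous_pi fun l => continuous_subtype_val.comp (continuous_apply l)

lemma isOpen_homCoord_pivotGeneric (F : PseudoFrame d k) (c : Fin k → Fin (d + 1)) :
    IsOpen {X : HomCoord d k | F.PivotGeneric c X.toMatrix} :=
  (F.isOpen_pivotGeneric c).preimage continuous_homCoord_val

lemma isOpen_freeShapes (hk : 0 < k) : IsOpen (freeShapes d k) := by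
  rw [← isOpenQuotientMap_homCoordShape.isQuotientMap.isOpen_preimage]
  have h : HomCoord.shape ⁻¹' freeShapes d k = ⋃ (F : PseudoFrame d k) (c : Fin k → Fin (d + 1)),
      {X : HomCoord d k | F.PivotGeneric c X.toMatrix} := by
    ext X
    simp only [Set.mem_preimage, HomCoord.isFree_iff_shape_mem, Set.mem_iUnion, Set.mem_ofPred_eq]
    constructor
    · intro h
      obtain ⟨F, hF⟩ := exists_generic_of_isFree hk h
      obtain ⟨c, -, hc⟩ := hF.exists_pivot
      exact ⟨F, c, hc⟩
    · rintro ⟨F, c, h⟩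
      exact h.toGeneric.isFree
  rw [h]
  exact isOpen_iUnion fun F => isOpen_iUnion fun c => isOpen_homCoord_pivotGeneric F c

/-- The projection from homogeneous coordinates of free configurations to free shapes. -/
def freeProj : HomCoord.shape ⁻¹' freeShapes d k → FreeShape d k :=
  (freeShapes d k).restrictPreimage HomCoord.shape

lemma isOpenQuotientMap_freeProj : IsOpenQuotientMap (freeProj (d := d) (k := k)) :=
  isOpenQuotientMap_homCoordShape.restrictPreimage _

lemma PseudoFrame.isOpen_chartDomain (F : PseudoFrame d k) (c : Fin k → Fin (d + 1)) :
    IsOpen (F.chartDomain c) := by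
  rw [← isOpenQuotientMap_freeProj.isQuotientMap.isOpen_preimage]
  have h : freeProj ⁻¹' F.chartDomain c =
      Subtype.val ⁻¹' {X : HomCoord d k | F.PivotGeneric c X.toMatrix} := by
    ext X
    exact F.mem_chartDomain_iff (X := X.1) rfl
  rw [h]
  exact (isOpen_homCoord_pivotGeneric F c).preimage continuous_subtype_val

/-- The chart normalises any homogeneous coordinates of the shape and reads off the affine
parameters; its inverse takes the shape of the matrix `A x`. -/
lemma PseudoFrame.exists_isChart [Nonempty (FreeShape d k)] {F : PseudoFrame d k}
    {c : Fin k → Fin (d + 1)} (hc : F.IsPivot c) :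
    ∃ e : OpenPartialHomeomorph (FreeShape d k) (EuclideanSpace ℝ (Fin (d * (k - d - 2)))),
      F.IsChart c e := by
  classical
  obtain ⟨A, hA, hrange⟩ := F.exists_affineMap_range_eq c
  obtain ⟨L, hL, hLA⟩ := exists_contDiff_leftInverse hA
  have hN : ∀ x, F.IsNormalForm c (A x) := fun x => hrange.le ⟨x, rfl⟩
  let H : EuclideanSpace ℝ (Fin (d * (k - d - 2))) → HomCoord d k :=
    fun x l => ⟨A x l, (hN x).row_ne_zero l⟩
  have hH : Continuous H := continuous_pi fun l => Continuous.subtype_mk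
    (continuous_pi fun j => (contDiff_affineMap_apply (n := 0) A l j).continuous) _
  -- This section is an arbitrary choice with no continuity; `hf` shows that the normal form does
  -- not depend on it.
  let r : FreeShape d k → HomCoord d k := fun s => rep s.1.out
  have hr : ∀ s, (r s).shape = s.1 := fun s => by
    rw [shape_rep]; exact Quotient.out_eq s.1
  let f : FreeShape d k → EuclideanSpace ℝ (Fin (d * (k - d - 2))) :=
    fun s => L (F.normalize c (r s).toMatrix)
  have hf : ∀ s ∈ F.chartDomain c, ∀ X : HomCoord d k, X.shape = s.1 →
      A (f s) = F.normalize c X.toMatrix := by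
    intro s hs X hX
    have h1 := (mem_chartDomain_iff (hr s)).1 hs
    have h2 := (mem_chartDomain_iff hX).1 hs
    obtain ⟨x, hx⟩ := hrange.ge h1.isNormalForm_normalize
    have h3 : A (f s) = F.normalize c (r s).toMatrix := by
      change A (L (F.normalize c (r s).toMatrix)) = _
      rw [← hx, hLA]
    rw [h3]
    refine h2.eq_normalize h1.isNormalForm_normalize ?_
    rw [hX, ← hr s]
    exact h1.represents_normalize
  have hfree : ∀ x, F.PivotGeneric c (A x) → (H x).shape ∈ freeShapes d k := fun x hx =>
    (H x).isFree_iff_shape_mem.2 (Generic.isFree (X := H x) hx.toGeneric)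
  -- Off the target the value is arbitrary.
  let g : EuclideanSpace ℝ (Fin (d * (k - d - 2))) → FreeShape d k := fun x =>
    if h : F.PivotGeneric c (A x) then ⟨(H x).shape, hfree x h⟩ else Classical.arbitrary _
  have hg : ∀ x, F.PivotGeneric c (A x) → (H x).shape = (g x).1 := by
    intro x hx
    simp only [g, dif_pos hx]
  have hgmem : ∀ x, F.PivotGeneric c (A x) → g x ∈ F.chartDomain c := fun x hx =>
    (mem_chartDomain_iff (hg x hx)).2 hx
  have hrep : ∀ s ∈ F.chartDomain c, Represents (A (f s)) s.1 := by
    intro s hs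
    rw [hf s hs _ (hr s), ← hr s]
    exact ((mem_chartDomain_iff (hr s)).1 hs).represents_normalize
  have hHf : ∀ s ∈ F.chartDomain c, (H (f s)).shape = s.1 := by
    intro s hs
    obtain ⟨Y, hY, hYs⟩ := represents_iff.1 (hrep s hs)
    rw [← hYs, HomCoord.shape_eq_iff, hY]
    exact ⟨fun _ => 1, fun _ => one_ne_zero, 1, by simp; rfl⟩
  have hfmem : ∀ s ∈ F.chartDomain c, F.PivotGeneric c (A (f s)) := fun s hs =>
    (mem_chartDomain_iff (hHf s hs)).1 hs
  refine ⟨{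
    toFun := f
    invFun := g
    source := F.chartDomain c
    target := {x | F.PivotGeneric c (A x)}
    map_source' := hfmem
    map_target' := hgmem
    left_inv' := fun s hs => Subtype.ext ((hg _ (hfmem s hs)).symm.trans (hHf s hs))
    right_inv' := fun x hx => ?_
    open_source := F.isOpen_chartDomain c
    open_target := ?_
    continuousOn_toFun := ?_
    continuousOn_invFun := ?_ }, hc, rfl, A, hA, fun s hs => ⟨hN _, hrep s hs⟩⟩
  · refine hA ?_
    rw [hf _ (hgmem x hx) _ (hg x hx)]
    refine (PivotGeneric.eq_normalize (X := H x) hx (hN x) ?_).symm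
    exact represents_iff.2 ⟨H x, rfl, rfl⟩
  · refine fun s hs => ContinuousAt.continuousWithinAt ?_
    obtain ⟨X, rfl⟩ := isOpenQuotientMap_freeProj.surjective s
    -- Continuity is tested upstairs, where near a point of the domain the chart is `L` after
    -- normalisation of the matrix itself.
    rw [← isOpenQuotientMap_freeProj.continuousAt_comp_iff]
    have hopen : IsOpen (freeProj ⁻¹' F.chartDomain c) :=
      (F.isOpen_chartDomain c).preimage isOpenQuotientMap_freeProj.continuous
    have h1 : ContinuousOn (fun Y : Fin k → Fin (d + 1) → ℝ => L (F.normalize c (Matrix.of Y)))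
        {Y | F.PivotGeneric c (Matrix.of Y)} := by
      refine hL.continuous.comp_continuousOn
        (continuousOn_pi.2 fun l => continuousOn_pi.2 fun j => ?_)
      exact (contDiffOn_normalize (n := 0)
        (fun i j => (contDiff_apply_apply ℝ ℝ i j).contDiffOn) (fun _ h => h) l j).continuousOn
    have h2 : ContinuousAt (fun X : HomCoord.shape ⁻¹' freeShapes d k =>
        L (F.normalize c X.1.toMatrix)) X :=
      (h1.continuousAt ((F.isOpen_pivotGeneric c).mem_nhds
        ((mem_chartDomain_iff (X := X.1) rfl).1 hs))).comp
        (f := fun X : HomCoord.shape ⁻¹' freeShapes d k => (X.1.toMatrix : Fin k → _ → ℝ))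
        (continuous_homCoord_val.comp continuous_subtype_val).continuousAt
    refine h2.congr (Filter.eventually_of_mem (hopen.mem_nhds hs) fun Y hY => ?_)
    change L (F.normalize c Y.1.toMatrix) = f (freeProj Y)
    rw [← hf _ hY Y.1 rfl, hLA]
  · rw [continuousOn_iff_continuous_domRestrict]
    have h1 : Continuous (fun x : {x | F.PivotGeneric c (A x)} =>
        (⟨(H x).shape, hfree x.1 x.2⟩ : FreeShape d k)) :=
      Continuous.subtype_mk (isOpenQuotientMap_homCoordShape.continuous.comp
        (hH.comp continuous_subtype_val)) _
    convert h1 using 1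
    funext x
    exact Subtype.ext (hg x.1 x.2).symm
  · exact (F.isOpen_pivotGeneric c).preimage (continuous_pi fun l => continuous_pi fun j =>
      (contDiff_affineMap_apply (n := 0) A l j).continuous)

/-- The matrix `A x` already represents the shape with parameter x, so the change of charts is `L`
after normalising `A x` for the second pseudo-frame. Only the defining property of a chart enters,
hence it covers every member of the atlas. -/
lemma PseudoFrame.IsChart.contDiffOn_symm_trans {n m : ℕ} {F F' : PseudoFrame d k}
    {c c' : Fin k → Fin (d + 1)}
    {e : OpenPartialHomeomorph (FreeShape d k) (EuclideanSpace ℝ (Fin n))}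
    {e' : OpenPartialHomeomorph (FreeShape d k) (EuclideanSpace ℝ (Fin m))}
    (he : F.IsChart c e) (he' : F'.IsChart c' e') :
    ContDiffOn ℝ ∞ (e' ∘ e.symm) (e.target ∩ e.symm ⁻¹' e'.source) := by
  obtain ⟨A, -, hA⟩ := he.normalForm
  obtain ⟨A', hA', hA2⟩ := he'.normalForm
  obtain ⟨L, hL, hLA⟩ := exists_contDiff_leftInverse hA'
  have key : ∀ x ∈ e.target ∩ e.symm ⁻¹' e'.source, F'.PivotGeneric c' (A x) ∧
      A' (e' (e.symm x)) = F'.normalize c' (A x) := by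
    rintro x ⟨hx, hx'⟩
    have h1 := hA _ (e.map_target hx)
    rw [e.right_inv hx] at h1
    obtain ⟨X, hX, hXs⟩ := represents_iff.1 h1.2
    have hx2 : e.symm x ∈ F'.chartDomain c' := he'.source_eq ▸ hx'
    rw [mem_chartDomain_iff hXs] at hx2
    rw [← hX]
    refine ⟨hx2, hx2.eq_normalize (hA2 _ hx').1 ?_⟩
    rw [hXs]
    exact (hA2 _ hx').2
  have h2 : ContDiffOn ℝ ∞ (fun x => L (F'.normalize c' (A x)))
      (e.target ∩ e.symm ⁻¹' e'.source) := by
    refine hL.comp_contDiffOn (contDiffOn_pi.2 fun l => contDiffOn_pi.2 fun j => ?_)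
    exact contDiffOn_normalize (fun i j => (contDiff_affineMap_apply A i j).contDiffOn)
      (fun x hx => (key x hx).1) l j
  refine h2.congr fun x hx => ?_
  rw [← (key x hx).2, hLA]
  rfl

/-! ### Failure of the Hausdorff property. -/

/-- A projective frame is a pseudo-frame: any spanning tree works, with l labelling all its edges.
-/
lemma isFree_of_base_of_row_one {X : HomCoord d k} {b : Fin (d + 1) ↪ Fin k}
    (hb : ∀ i, X.toMatrix (b i) = Pi.single i 1) {l : Fin k} (hl : l ∉ Set.range b)
    (h1 : ∀ j, X.toMatrix l j = 1) : IsFree X.config := by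
  obtain ⟨T, -, hT⟩ := (SimpleGraph.connected_top (V := Fin (d + 1))).exists_isTree_le
  have hsub : X.toMatrix.submatrix b id = 1 := by
    ext i j
    rw [submatrix_apply, hb, Matrix.one_eq_pi_single]
    rfl
  have hrel : relCoord b X.toMatrix = X.toMatrix := by
    rw [relCoord, hsub]; simp
  let F : PseudoFrame d k := ⟨b, T, hT, fun _ => l, fun _ => hl⟩
  have hF : F.Generic X.toMatrix := by
    refine ⟨?_, fun e v _ => ?_⟩
    · change IsUnit (X.toMatrix.submatrix b id)
      rw [hsub]; exact isUnit_one
    · change relCoord b X.toMatrix l v ≠ 0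
      rw [hrel, h1]; exact one_ne_zero
  exact hF.isFree

/-- Homogeneous coordinates with the standard basis in the rows `0, …, d`, with `v` in the row
`d + 1` and `w` in all other rows. -/
def frameCoord (k : ℕ) (v w : {v : Fin (d + 1) → ℝ // v ≠ 0}) : HomCoord d k := fun l =>
  if h : l.1 < d + 1 then ⟨Pi.single ⟨l.1, h⟩ 1, by simp⟩ else if l.1 = d + 1 then v else w

lemma frameCoord_castLE (v w : {v : Fin (d + 1) → ℝ // v ≠ 0}) (h : d + 1 ≤ k)
    (i : Fin (d + 1)) : (frameCoord k v w).toMatrix (Fin.castLE h i) = Pi.single i 1 :=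
  congrArg Subtype.val (dif_pos (show (Fin.castLE h i).1 < d + 1 from i.2))

lemma frameCoord_of_eq (v w : {v : Fin (d + 1) → ℝ // v ≠ 0}) {l : Fin k} (h : l.1 = d + 1) :
    (frameCoord k v w).toMatrix l = v.1 := by
  change (frameCoord k v w l).1 = v.1
  simp [frameCoord, h]

lemma frameCoord_of_lt (v w : {v : Fin (d + 1) → ℝ // v ≠ 0}) {l : Fin k} (h : d + 1 < l.1) :
    (frameCoord k v w).toMatrix l = w.1 := by
  change (frameCoord k v w l).1 = w.1
  rw [frameCoord, dif_neg (by omega), if_neg (by omega)]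

lemma continuous_frameCoord {v w : ℝ → {v : Fin (d + 1) → ℝ // v ≠ 0}} (hv : Continuous v)
    (hw : Continuous w) : Continuous fun ε => frameCoord k (v ε) (w ε) := by
  refine continuous_pi fun l => ?_
  unfold frameCoord
  split_ifs
  · exact continuous_const
  · exact hv
  · exact hw

lemma notMem_range_castLE {h : d + 1 ≤ k} {l : Fin k} (hl : d + 1 ≤ l.1) :
    l ∉ Set.range (Fin.castLEEmb h) := by
  rintro ⟨i, rfl⟩
  have := i.2
  simp at hl
  omega

lemma isFree_frameCoord {v w : {v : Fin (d + 1) → ℝ // v ≠ 0}} (hk : d + 3 ≤ k)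
    (h : (v.1 = fun _ => 1) ∨ w.1 = fun _ => 1) : IsFree (frameCoord k v w).config := by
  have hk' : d + 1 ≤ k := by omega
  rcases h with h | h
  · refine isFree_of_base_of_row_one (b := Fin.castLEEmb hk') (l := ⟨d + 1, by omega⟩)
      (fun i => frameCoord_castLE v w hk' i) (notMem_range_castLE le_rfl) fun j => ?_
    rw [frameCoord_of_eq v w rfl, h]
  · refine isFree_of_base_of_row_one (b := Fin.castLEEmb hk') (l := ⟨d + 2, by omega⟩)
      (fun i => frameCoord_castLE v w hk' i) (notMem_range_castLE (Nat.le_succ _)) fun j => ?_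
    rw [frameCoord_of_lt v w (Nat.lt_succ_self _), h]

lemma nonempty_freeShape (hk : d + 3 ≤ k) : Nonempty (FreeShape d k) := by
  have h : (fun _ => 1 : Fin (d + 1) → ℝ) ≠ 0 := Function.ne_iff.2 ⟨0, one_ne_zero⟩
  exact ⟨⟨_, _, isFree_frameCoord (v := ⟨_, h⟩) (w := ⟨_, h⟩) hk (Or.inl rfl), rfl⟩⟩

/-- Beyond the standard basis, x has rows (ε, 1, …, 1) and (1, …, 1), while y has (1, …, 1) and (1,
ε, …, ε). For ε ≠ 0 they have equal shape, so in a Hausdorff space the limits at 0 would coincide;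
but their patterns of zeros differ. -/
lemma not_t2Space_freeShape (hd : 1 ≤ d) (hk : d + 3 ≤ k) : ¬ T2Space (FreeShape d k) := by
  intro hT2
  have hk' : d + 1 ≤ k := by omega
  let i₁ : Fin (d + 1) := ⟨1, by omega⟩
  have hi₁ : i₁ ≠ 0 := fun h => one_ne_zero (congrArg Fin.val h)
  let one : {v : Fin (d + 1) → ℝ // v ≠ 0} :=
    ⟨fun _ => 1, Function.ne_iff.2 ⟨0, one_ne_zero⟩⟩
  let v : ℝ → {v : Fin (d + 1) → ℝ // v ≠ 0} := fun ε =>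
    ⟨Function.update (fun _ => 1) 0 ε, Function.ne_iff.2 ⟨i₁, by simp [hi₁]⟩⟩
  let w : ℝ → {v : Fin (d + 1) → ℝ // v ≠ 0} := fun ε =>
    ⟨Function.update (fun _ => ε) 0 1, Function.ne_iff.2 ⟨0, by simp⟩⟩
  have hv : Continuous v := Continuous.subtype_mk
    ((continuous_const (y := (fun _ => 1 : Fin (d + 1) → ℝ))).update 0 continuous_id) _
  have hw : Continuous w := Continuous.subtype_mk
    ((continuous_pi fun _ => continuous_id).update 0 continuous_const) _
  let X : ℝ → HomCoord d k := fun ε => frameCoord k (v ε) one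
  let Y : ℝ → HomCoord d k := fun ε => frameCoord k one (w ε)
  have hX : ∀ ε, IsFree (X ε).config := fun ε => isFree_frameCoord hk (Or.inr rfl)
  have hY : ∀ ε, IsFree (Y ε).config := fun ε => isFree_frameCoord hk (Or.inl rfl)
  let x : ℝ → FreeShape d k := fun ε => ⟨(X ε).shape, (X ε).isFree_iff_shape_mem.2 (hX ε)⟩
  let y : ℝ → FreeShape d k := fun ε => ⟨(Y ε).shape, (Y ε).isFree_iff_shape_mem.2 (hY ε)⟩
  have hx : Continuous x := Continuous.subtype_mk (isOpenQuotientMap_homCoordShape.continuous.comp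
    (continuous_frameCoord hv continuous_const)) _
  have hy : Continuous y := Continuous.subtype_mk (isOpenQuotientMap_homCoordShape.continuous.comp
    (continuous_frameCoord continuous_const hw)) _
  have hxy : Set.EqOn x y {0}ᶜ := by
    intro ε hε
    have hε : ε ≠ 0 := hε
    refine Subtype.ext ((HomCoord.shape_eq_iff _ _).2 ?_)
    have hB : IsUnit (diagonal (Function.update (fun _ => 1) 0 ε⁻¹ : Fin (d + 1) → ℝ)) := by
      rw [isUnit_diagonal, Pi.isUnit_iff]
      intro i
      by_cases hi : i = 0
      · subst hi; simpa using hε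
      · simp [hi]
    -- Column 0 is divided by ε. Row 0 is multiplied by ε to restore its basis vector, and the rows
    -- past d + 1 to turn 1s into (1, ε, …, ε).
    refine ⟨fun l => if l.1 = 0 ∨ d + 1 < l.1 then ε else 1, fun l => ?_, hB.unit, ?_⟩
    · dsimp only
      split_ifs <;> simp [hε]
    · ext l j
      rw [IsUnit.unit_spec, mul_diagonal, diagonal_mul]
      rcases lt_trichotomy l.1 (d + 1) with hl | hl | hl
      · obtain ⟨i, rfl⟩ : ∃ i, Fin.castLE hk' i = l := ⟨⟨l.1, hl⟩, rfl⟩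
        rw [frameCoord_castLE, frameCoord_castLE]
        by_cases hij : j = i
        · subst hij
          have h1 : ¬ d + 1 < j.1 := by omega
          by_cases hj : j = 0
          · subst hj; simp [hε]
          · simp [hj, h1]
        · simp [hij]
      · rw [frameCoord_of_eq _ _ hl, frameCoord_of_eq _ _ hl]
        have h1 : ¬ (l.1 = 0 ∨ d + 1 < l.1) := by omega
        rw [if_neg h1]
        by_cases hj : j = 0
        · subst hj; simp [v, one, hε]
        · simp [v, one, hj]
      · rw [frameCoord_of_lt _ _ hl, frameCoord_of_lt _ _ hl]
        rw [if_pos (Or.inr hl)]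
        by_cases hj : j = 0
        · subst hj; simp [w, one, hε]
        · simp [w, one, hj]
  have h0 : x 0 = y 0 :=
    congrFun (Continuous.ext_on (dense_compl_singleton (0 : ℝ)) hx hy hxy) 0
  obtain ⟨D, hD, B, hB⟩ := (HomCoord.shape_eq_iff _ _).1 (congrArg Subtype.val h0)
  have hrel : ∀ v w, relCoord (Fin.castLEEmb hk') (frameCoord k v w).toMatrix =
      (frameCoord k v w).toMatrix := by
    intro v w
    have hsub : (frameCoord k v w).toMatrix.submatrix (Fin.castLEEmb hk') id = 1 := by
      ext i j
      rw [Matrix.one_eq_pi_single, ← frameCoord_castLE v w hk']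
      rfl
    rw [relCoord, hsub]; simp
  -- The entry at (d + 2, 1) is 1 for x and 0 for y at ε = 0.
  have h1 := relCoord_diagonal_mul_mul (Fin.castLEEmb hk') hD (X 0).toMatrix B ⟨d + 2, by omega⟩ i₁
  rw [← hB, hrel, hrel, frameCoord_of_lt _ _ (Nat.lt_succ_self _),
    frameCoord_of_lt _ _ (Nat.lt_succ_self _)] at h1
  simp only [w, one, Function.update_of_ne hi₁, mul_one] at h1
  exact mul_ne_zero (hD _) (inv_ne_zero (hD _)) h1.symm

/-! ### Second countability, unblurriness and the theorem. -/

lemma secondCountableTopology_freeShape : SecondCountableTopology (FreeShape d k) :=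
  isOpenQuotientMap_freeProj.isQuotientMap.secondCountableTopology
    isOpenQuotientMap_freeProj.isOpenMap

/-- For another point y of U, removing y from U leaves a neighbourhood of x that is open in the
whole space. -/
lemma unblurry_of_mem_isOpen {M : Type*} [TopologicalSpace M] {U : Set M} (hU : IsOpen U)
    [T1Space U] {x : M} (hx : x ∈ U) : Unblurry x := by
  refine Set.Subset.antisymm (fun y hy => ?_) ?_
  · have hyU : y ∈ U := hy U ⟨hU, hx⟩
    by_contra hne
    have h1 : IsOpen (Subtype.val '' ({⟨y, hyU⟩}ᶜ : Set U)) :=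
      hU.isOpenMap_subtype_val _ isOpen_compl_singleton
    obtain ⟨z, hz, hzy⟩ := hy _ ⟨h1, ⟨x, hx⟩, fun h => hne (congrArg Subtype.val h).symm, rfl⟩
    exact hz (Subtype.ext hzy)
  · rintro _ rfl
    exact fun U hU => hU.2

end ProjectiveShape

end

open ProjectiveShape in
theorem mainTheorem1 (d k : ℕ) (hd : 1 ≤ d) (hk : d + 3 ≤ k) :
    (∃ _ : ChartedSpace (EuclideanSpace ℝ (Fin (d * (k - d - 2))))
        (ProjectiveShape.FreeShape d k),
      IsManifold 𝓘(ℝ, EuclideanSpace ℝ (Fin (d * (k - d - 2)))) ∞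
        (ProjectiveShape.FreeShape d k) ∧
      atlas (EuclideanSpace ℝ (Fin (d * (k - d - 2)))) (ProjectiveShape.FreeShape d k) =
        {e | ∃ (F : ProjectiveShape.PseudoFrame d k) (c : Fin k → Fin (d + 1)), F.IsChart c e} ∧
      ∀ (F : ProjectiveShape.PseudoFrame d k) (c : Fin k → Fin (d + 1)), F.IsPivot c →
        ∃ e ∈ atlas (EuclideanSpace ℝ (Fin (d * (k - d - 2)))) (ProjectiveShape.FreeShape d k),
          F.IsChart c e) ∧
    SecondCountableTopology (ProjectiveShape.FreeShape d k) ∧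
    T1Space (ProjectiveShape.FreeShape d k) ∧
    ¬ T2Space (ProjectiveShape.FreeShape d k) ∧
    IsOpen (ProjectiveShape.freeShapes d k) ∧
    (∀ s ∈ ProjectiveShape.freeShapes d k, ProjectiveShape.Unblurry s) := by
  have hk0 : 0 < k := by omega
  have := nonempty_freeShape hk
  have hcover : ∀ s : FreeShape d k,
      ∃ e : OpenPartialHomeomorph (FreeShape d k) (EuclideanSpace ℝ (Fin (d * (k - d - 2)))),
        (∃ F c, PseudoFrame.IsChart F c e) ∧ s ∈ e.source := by
    intro s
    obtain ⟨F, c, hc, hs⟩ := exists_mem_chartDomain hk0 s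
    obtain ⟨e, he⟩ := PseudoFrame.exists_isChart hc
    exact ⟨e, ⟨F, c, he⟩, he.source_eq ▸ hs⟩
  choose ch hch hsource using hcover
  let cs : ChartedSpace (EuclideanSpace ℝ (Fin (d * (k - d - 2)))) (FreeShape d k) :=
    { atlas := {e | ∃ F c, PseudoFrame.IsChart F c e}
      chartAt := ch
      mem_chart_source := hsource
      chart_mem_atlas := hch }
  -- T1 is a local property: a point off the chart domain of x is separated from x by that domain,
  -- any other inside the chart.
  have hT1 : T1Space (FreeShape d k) :=
    ChartedSpace.t1Space (EuclideanSpace ℝ (Fin (d * (k - d - 2)))) (FreeShape d k)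
  refine ⟨⟨cs, ?_, rfl, fun F c hc => ?_⟩, secondCountableTopology_freeShape, hT1,
    not_t2Space_freeShape hd hk, isOpen_freeShapes hk0,
    fun s hs => unblurry_of_mem_isOpen (isOpen_freeShapes hk0) hs⟩
  · refine isManifold_of_contDiffOn _ _ _ ?_
    rintro e e' ⟨F, c, he⟩ ⟨F', c', he'⟩
    simpa only [mfld_simps] using he.contDiffOn_symm_trans he'
  · obtain ⟨e, he⟩ := PseudoFrame.exists_isChart hc
    exact ⟨e, ⟨F, c, he⟩, he⟩
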